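/- Let $n\ge 1$ and let $\Omega\subset\mathbb R^n$ be a bounded open set with Lipschitz boundary, with surface measure $\sigma$ and outward unit normal $\nu$ on $\partial\Omega$. Let $\Gamma_0,\Gamma_1\subset\partial\Omega$ be disjoint and relatively open, with $\overline{\Gamma_0}\cup\overline{\Gamma_1}=\partial\Omega$, and such that their boundaries within $\partial\Omega$ have surface measure zero. All vector spaces are real. Let $H^1(\Omega)$ and $H^{\mathrm{div}}(\Omega)=\{f\in L^2(\Omega)^n:\operatorname{div}f\in L^2(\Omega)\}$ carry the graph norms of the distributional gradient and divergence. The Dirichlet trace $\gamma_0:H^1(\Omega)\to L^2(\partial\Omega)$ is the continuous extension of $\varphi\mapsto\varphi|_{\partial\Omega}$, $\varphi\in C^\infty(\overline\Omega)$, and $H^{1/2}(\partial\Omega)=\gamma_0H^1(\Omega)$ with the norm $\|h\|=\inf\{\|u\|_{H^1(\Omega)}:\gamma_0u=h\}$. Put $$E_0=H^1_{\Gamma_0}(\Omega)=\{u\in H^1(\Omega):(\gamma_0u)|_{\Gamma_0}=0\},\qquad \mathcal W=\{h\in H^{1/2}(\partial\Omega):h|_{\Gamma_0}=0\},\qquad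 U=L^2(\Gamma_1),$$ with inherited norms. Let $E_0'$ be the dual of $E_0$ with pivot space $L^2(\Omega)$, and let $\mathcal W'$ be the dual of $\mathcal W$ with pivot space $U$, so that $g\in U$ is identified with the functional $h\mapsto\langle g,h|_{\Gamma_1}\rangle_U$. The normal trace $\gamma_\perp:H^{\mathrm{div}}(\Omega)\to\mathcal W'$ is the continuous extension of $f\mapsto(\nu\cdot f)|_{\Gamma_1}\in U\subset\mathcal W'$, $f\in C^\infty(\overline\Omega)^n$. Let $L=-\nabla|_{E_0}\in\mathcal L(E_0;L^2(\Omega)^n)$ and $K_0=\gamma_0|_{E_0}\in\mathcal L(E_0;U)$; let $L'\in\mathcal L(L^2(\Omega)^n;E_0')$ be the bounded dual of $L$, and $K_0'\in\mathcal L(U;E_0')$ that of $K_0$. As $K_0$ is also a bounded operator from $E_0$ to $\mathcal W$, $K_0'$ also denotes the dual operator $\mathcal W'\to E_0'$. Then $\gamma_0$ and $\gamma_\perp$ are well defined: $C^\infty(\overline\Omega)$ is dense in $H^1(\Omega)$, $C^\infty(\overline\Omega)^n$ is dense in $H^{\mathrm{div}}(\Omega)$, and the continuous extensions exist. The identification $U\to\mathcal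 W'$ is injective, and the operator $K_0':\mathcal W'\to E_0'$ extends $K_0':U\to E_0'$. Moreover, $$L'f=\operatorname{div}f-K_0'\gamma_\perp f\quad\text{in }E_0',\qquad f\in H^{\mathrm{div}}(\Omega),$$ and $K_0'$ is injective, both on $U$ and on $\mathcal W'$. -/

import Mathlib

open MeasureTheory Set
open scoped ContDiff NNReal InnerProductSpace

noncomputable section

/-- The Euclidean space `ℝⁿ`. -/
abbrev Euc (n : ℕ) : Type := EuclideanSpace ℝ (Fin n)

/-! ### Abstract duals -/

/-- The bounded dual `T' : U → X'` of a bounded operator `T : X → U` into a real Hilbert space `U`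
which is identified with its own dual: `⟨T' g, x⟩ = ⟪g, T x⟫`. -/
def pivotDual {X U : Type*} [SeminormedAddCommGroup X] [NormedSpace ℝ X]
    [NormedAddCommGroup U] [InnerProductSpace ℝ U] (T : X →L[ℝ] U) :
    U →L[ℝ] StrongDual ℝ X :=
  LinearMap.mkContinuous
    { toFun := fun g => (innerSL ℝ g).comp T
      map_add' := fun g h => by ext x; simp
      map_smul' := fun c g => by ext x; simp }
    ‖T‖ (fun g => by
      refine (ContinuousLinearMap.opNorm_comp_le _ _).trans ?_
      rw [innerSL_apply_norm, mul_comm])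

/-- The bounded dual `S' : W' → X'` of a bounded operator `S : X → W`: `⟨S' ℓ, x⟩ = ⟨ℓ, S x⟩`. -/
def boundedDual {X W : Type*} [SeminormedAddCommGroup X] [NormedSpace ℝ X]
    [SeminormedAddCommGroup W] [NormedSpace ℝ W] (S : X →L[ℝ] W) :
    StrongDual ℝ W →L[ℝ] StrongDual ℝ X :=
  ContinuousLinearMap.precomp ℝ S

/-! ### Lipschitz charts -/

/-- A bounded open set `nbhd` of `ℝᵈ⁺¹`, new orthonormal coordinates `rot x = (x', x_{d+1})` and a
Lipschitz function `φ` of `x'`, whose graph will describe a boundary inside `nbhd`. -/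
structure LipschitzChart (d : ℕ) where
  nbhd : Set (Euc (d + 1))
  isOpen_nbhd : IsOpen nbhd
  isBounded_nbhd : Bornology.IsBounded nbhd
  rot : Euc (d + 1) ≃ₗᵢ[ℝ] Euc (d + 1)
  φ : Euc d → ℝ
  lipschitz : ∃ K : ℝ≥0, LipschitzWith K φ

namespace LipschitzChart

variable {d : ℕ} (c : LipschitzChart d)

/-- The point of `ℝᵈ⁺¹` with coordinates `(y, t)` in the rotated coordinate system. -/
def point (y : Euc d) (t : ℝ) : Euc (d + 1) :=
  c.rot.symm (WithLp.toLp 2 (Fin.snoc (α := fun _ => ℝ) (fun i => y i) t))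

/-- The first `d` rotated coordinates `x'` of `x`. -/
def base (x : Euc (d + 1)) : Euc d := WithLp.toLp 2 fun i => c.rot x (Fin.castSucc i)

/-- The last rotated coordinate of `x`. -/
def height (x : Euc (d + 1)) : ℝ := c.rot x (Fin.last d)

/-- The area density `√(1 + |∇φ|²)` of the graph of `φ`. -/
def areaDensity (y : Euc d) : ℝ := √(1 + ‖gradient c.φ y‖ ^ 2)

/-- The surface measure of the part of the graph of `φ` that lies in `nbhd`. -/
def graphMeasure : Measure (Euc (d + 1)) :=
  (((volume : Measure (Euc d)).withDensity fun y => ENNReal.ofReal (c.areaDensity y)).map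
    fun y => c.point y (c.φ y)).restrict c.nbhd

/-- The unit normal `(-∇φ, 1) / √(1 + |∇φ|²)` of the graph of `φ`, pointing upwards. -/
def graphNormal (x : Euc (d + 1)) : Euc (d + 1) :=
  (c.areaDensity (c.base x))⁻¹ • c.point (-gradient c.φ (c.base x)) 1

lemma continuous_φ : Continuous c.φ := c.lipschitz.choose_spec.continuous

lemma continuous_point : Continuous fun p : Euc d × ℝ => c.point p.1 p.2 := by
  unfold point
  refine c.rot.symm.continuous.comp ((PiLp.continuous_toLp 2 _).comp ?_)
  refine continuous_pi fun i => ?_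
  refine Fin.lastCases ?_ (fun j => ?_) i
  · simpa using continuous_snd
  · simp only [Fin.snoc_castSucc]
    fun_prop

lemma continuous_base : Continuous c.base := by
  unfold base
  refine (PiLp.continuous_toLp 2 _).comp (continuous_pi fun i => ?_)
  have := c.rot.continuous
  fun_prop

lemma base_point (y : Euc d) (t : ℝ) : c.base (c.point y t) = y := by
  ext i; simp [base, point]

lemma measurable_gradient : Measurable (gradient c.φ) := by
  unfold gradient
  exact (InnerProductSpace.toDual ℝ (Euc d)).symm.continuous.measurable.comp
    (measurable_fderiv ℝ c.φ)

lemma measurable_areaDensity : Measurable c.areaDensity := by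
  unfold areaDensity
  have := c.measurable_gradient
  fun_prop

lemma measurable_graphNormal : Measurable c.graphNormal := by
  unfold graphNormal
  have hb := c.continuous_base.measurable
  have h1 := (c.measurable_areaDensity.comp hb).inv
  have h2 : Measurable fun x => c.point (-gradient c.φ (c.base x)) 1 :=
    c.continuous_point.measurable.comp
      ((c.measurable_gradient.comp hb).neg.prodMk measurable_const)
  exact h1.smul h2

lemma norm_point_sq (y : Euc d) (t : ℝ) : ‖c.point y t‖ ^ 2 = ‖y‖ ^ 2 + t ^ 2 := by
  simp [point, EuclideanSpace.norm_sq_eq, Fin.sum_univ_castSucc]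

lemma norm_graphNormal (x : Euc (d + 1)) : ‖c.graphNormal x‖ = 1 := by
  have h : ‖c.point (-gradient c.φ (c.base x)) 1‖ = c.areaDensity (c.base x) := by
    rw [areaDensity, ← Real.sqrt_sq (norm_nonneg (c.point _ _)), norm_point_sq, norm_neg,
      one_pow, add_comm]
  have hpos : 0 < c.areaDensity (c.base x) := by unfold areaDensity; positivity
  rw [graphNormal, norm_smul, h, norm_inv, Real.norm_of_nonneg hpos.le, inv_mul_cancel₀ hpos.ne']

lemma areaDensity_le : ∃ M : ℝ, ∀ y, c.areaDensity y ≤ M := by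
  obtain ⟨K, hK⟩ := c.lipschitz
  refine ⟨√(1 + (K : ℝ) ^ 2), fun y => Real.sqrt_le_sqrt ?_⟩
  have : ‖gradient c.φ y‖ ≤ K := by
    unfold gradient
    rw [LinearIsometryEquiv.norm_map]
    exact norm_fderiv_le_of_lipschitz ℝ hK
  gcongr

instance : IsFiniteMeasure c.graphMeasure := by
  obtain ⟨M, hM⟩ := c.areaDensity_le
  have hmeas : Measurable fun y : Euc d => c.point y (c.φ y) :=
    (c.continuous_point.comp (continuous_id.prodMk c.continuous_φ)).measurable
  refine ⟨?_⟩
  rw [graphMeasure, Measure.restrict_apply_univ,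
    Measure.map_apply hmeas c.isOpen_nbhd.measurableSet,
    withDensity_apply _ (hmeas c.isOpen_nbhd.measurableSet)]
  obtain ⟨R, hR⟩ := c.isBounded_nbhd.subset_closedBall 0
  have hb : (fun y : Euc d => c.point y (c.φ y)) ⁻¹' c.nbhd ⊆ Metric.closedBall 0 R := by
    intro y hy
    have h1 : ‖c.point y (c.φ y)‖ ≤ R := by simpa using hR hy
    have h2 := c.norm_point_sq y (c.φ y)
    have h3 : ‖y‖ ≤ ‖c.point y (c.φ y)‖ :=
      le_of_sq_le_sq (by nlinarith [sq_nonneg (c.φ y)]) (norm_nonneg _)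
    simpa using h3.trans h1
  calc ∫⁻ y in (fun y : Euc d => c.point y (c.φ y)) ⁻¹' c.nbhd, ENNReal.ofReal (c.areaDensity y)
      ≤ ∫⁻ _ in (fun y : Euc d => c.point y (c.φ y)) ⁻¹' c.nbhd, ENNReal.ofReal M :=
        lintegral_mono fun y => ENNReal.ofReal_le_ofReal (hM y)
    _ = ENNReal.ofReal M * volume ((fun y : Euc d => c.point y (c.φ y)) ⁻¹' c.nbhd) := by simp
    _ < ⊤ := ENNReal.mul_lt_top ENNReal.ofReal_lt_top
        ((measure_mono hb).trans_lt measure_closedBall_lt_top)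

end LipschitzChart

/-- A bounded open subset of `ℝᵈ⁺¹` with Lipschitz boundary, with a finite atlas: near each of its
boundary points it is the region below the graph of a Lipschitz function in rotated coordinates. -/
structure LipschitzDomain (d : ℕ) where
  carrier : Set (Euc (d + 1))
  isOpen : IsOpen carrier
  isBounded : Bornology.IsBounded carrier
  N : ℕ
  chart : Fin N → LipschitzChart d
  frontier_subset : frontier carrier ⊆ ⋃ i, (chart i).nbhd
  mem_iff : ∀ i, ∀ x ∈ (chart i).nbhd,
    x ∈ carrier ↔ (chart i).height x < (chart i).φ ((chart i).base x)

/-- The real vector space of smooth functions on `ℝⁿ` with values in `F`. Their restrictions to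
`Ω` form the space `C^∞(closure Ω)`. -/
def smoothFunctions (n : ℕ) (F : Type*) [NormedAddCommGroup F] [NormedSpace ℝ F] :
    Submodule ℝ (Euc n → F) where
  carrier := {f | ContDiff ℝ ∞ f}
  add_mem' {f g} (hf : ContDiff ℝ ∞ f) (hg : ContDiff ℝ ∞ g) := hf.add hg
  zero_mem' := show ContDiff ℝ ∞ fun _ : Euc n => (0 : F) from contDiff_const
  smul_mem' c f (hf : ContDiff ℝ ∞ f) := hf.const_smul c

lemma contDiff_of_smooth {n : ℕ} {F : Type*} [NormedAddCommGroup F] [NormedSpace ℝ F]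
    (f : smoothFunctions n F) : ContDiff ℝ ∞ f.1 := f.2

/-- The classical divergence `∑ᵢ ∂ᵢ fᵢ`. -/
def divergence {n : ℕ} (f : Euc n → Euc n) (x : Euc n) : ℝ :=
  ∑ i, fderiv ℝ f x (EuclideanSpace.single i 1) i

/-- Test functions: smooth real functions whose support is a compact subset of `Ω`. -/
def IsTestFunction {n : ℕ} (Ω : Set (Euc n)) (ψ : Euc n → ℝ) : Prop :=
  ContDiff ℝ ∞ ψ ∧ HasCompactSupport ψ ∧ tsupport ψ ⊆ Ω

/-- `v` is the distributional gradient of `u` on `Ω`: `∫ u ∂ₑψ = -∫ (v · e) ψ` for all test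
functions `ψ` and all directions `e`. -/
def HasWeakGradient {n : ℕ} (Ω : Set (Euc n)) (u : Euc n → ℝ) (v : Euc n → Euc n) : Prop :=
  ∀ ψ, IsTestFunction Ω ψ → ∀ e : Euc n,
    ∫ x in Ω, u x * fderiv ℝ ψ x e = -∫ x in Ω, ⟪v x, e⟫_ℝ * ψ x

/-- `g` is the distributional divergence of `f` on `Ω`: `∫ f · ∇ψ = -∫ g ψ` for all test
functions `ψ`. -/
def HasWeakDivergence {n : ℕ} (Ω : Set (Euc n)) (f : Euc n → Euc n) (g : Euc n → ℝ) : Prop :=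
  ∀ ψ, IsTestFunction Ω ψ → ∫ x in Ω, fderiv ℝ ψ x (f x) = -∫ x in Ω, g x * ψ x

namespace LipschitzDomain

variable {d : ℕ} (D : LipschitzDomain d)

/-! ### Surface measure and outward unit normal -/

/-- The charts' neighbourhoods made disjoint. -/
def piece (i : Fin D.N) : Set (Euc (d + 1)) := (D.chart i).nbhd \ ⋃ j < i, (D.chart j).nbhd

/-- The surface measure of the boundary. -/
def surfaceMeasure : Measure (Euc (d + 1)) :=
  ∑ i, (D.chart i).graphMeasure.restrict (D.piece i)

/-- The outward unit normal, defined almost everywhere on the boundary. -/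
def normal (x : Euc (d + 1)) : Euc (d + 1) :=
  ∑ i, (D.piece i).indicator (D.chart i).graphNormal x

lemma measurableSet_piece (i : Fin D.N) : MeasurableSet (D.piece i) :=
  (D.chart i).isOpen_nbhd.measurableSet.diff
    (MeasurableSet.iUnion fun j => MeasurableSet.iUnion fun _ =>
      (D.chart j).isOpen_nbhd.measurableSet)

instance : IsFiniteMeasure D.surfaceMeasure := by
  unfold surfaceMeasure; infer_instance

instance : IsFiniteMeasure ((volume : Measure (Euc (d + 1))).restrict D.carrier) :=
  ⟨by simpa using D.isBounded.measure_lt_top⟩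

lemma measurable_normal : Measurable D.normal := by
  unfold normal
  exact Finset.measurable_fun_sum _ fun i _ =>
    (D.chart i).measurable_graphNormal.indicator (D.measurableSet_piece i)

lemma norm_normal_le (x : Euc (d + 1)) : ‖D.normal x‖ ≤ D.N := by
  unfold normal
  refine (norm_sum_le _ _).trans ?_
  calc ∑ i, ‖(D.piece i).indicator (D.chart i).graphNormal x‖ ≤ ∑ _i : Fin D.N, (1 : ℝ) :=
        Finset.sum_le_sum fun i _ => (norm_indicator_le_norm_self _ _).trans
          ((D.chart i).norm_graphNormal x).le
    _ = D.N := by simp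

/-! ### Lebesgue spaces -/

/-- `L²(Ω)`. -/
abbrev L2 : Type := Lp ℝ 2 ((volume : Measure (Euc (d + 1))).restrict D.carrier)

/-- `L²(Ω)ⁿ`. -/
abbrev L2Vec : Type := Lp (Euc (d + 1)) 2 ((volume : Measure (Euc (d + 1))).restrict D.carrier)

/-- `L²(∂Ω)`. -/
abbrev L2Boundary : Type := Lp ℝ 2 D.surfaceMeasure

/-- `L²(Γ)` for a part `Γ` of the boundary. -/
abbrev L2Part (Γ : Set (Euc (d + 1))) : Type := Lp ℝ 2 (D.surfaceMeasure.restrict Γ)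

/-- The restriction `h ↦ h|_Γ` from `L²(∂Ω)` to `L²(Γ)`. -/
def restrictTo (Γ : Set (Euc (d + 1))) : D.L2Boundary →L[ℝ] D.L2Part Γ :=
  LpToLpRestrictCLM (Euc (d + 1)) ℝ ℝ D.surfaceMeasure 2 Γ

lemma memLp_of_continuous {F : Type*} [NormedAddCommGroup F] {f : Euc (d + 1) → F}
    (hf : Continuous f) {μ : Measure (Euc (d + 1))} [IsFiniteMeasure μ]
    {B : Set (Euc (d + 1))} (hB : Bornology.IsBounded B) (hμ : ∀ᵐ x ∂μ, x ∈ B) :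
    MemLp f 2 μ := by
  obtain ⟨C, hC⟩ := hB.isCompact_closure.exists_bound_of_continuousOn hf.continuousOn
  exact MemLp.of_bound hf.aestronglyMeasurable C
    (hμ.mono fun x hx => hC x (subset_closure hx))

lemma memLp_carrier {F : Type*} [NormedAddCommGroup F] {f : Euc (d + 1) → F}
    (hf : Continuous f) : MemLp f 2 ((volume : Measure (Euc (d + 1))).restrict D.carrier) :=
  memLp_of_continuous hf D.isBounded (ae_restrict_mem D.isOpen.measurableSet)

lemma ae_surfaceMeasure : ∀ᵐ x ∂D.surfaceMeasure, x ∈ ⋃ i, (D.chart i).nbhd := by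
  rw [ae_iff, surfaceMeasure, Measure.finsetSum_apply]
  refine Finset.sum_eq_zero fun i _ => ?_
  refine measure_mono_null (t := (D.piece i)ᶜ) ?_ ?_
  · intro x hx hxi
    exact hx (mem_iUnion.2 ⟨i, hxi.1⟩)
  · rw [Measure.restrict_apply (D.measurableSet_piece i).compl]
    simp

lemma isBounded_charts : Bornology.IsBounded (⋃ i, (D.chart i).nbhd) :=
  Bornology.isBounded_iUnion.2 fun i => (D.chart i).isBounded_nbhd

lemma memLp_boundary {F : Type*} [NormedAddCommGroup F] {f : Euc (d + 1) → F}
    (hf : Continuous f) : MemLp f 2 D.surfaceMeasure :=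
  memLp_of_continuous hf D.isBounded_charts D.ae_surfaceMeasure

lemma memLp_normal_inner {f : Euc (d + 1) → Euc (d + 1)} (hf : Continuous f) :
    MemLp (fun x => ⟪D.normal x, f x⟫_ℝ) 2 D.surfaceMeasure := by
  refine (D.memLp_boundary hf).of_le_mul (c := D.N)
    ((D.measurable_normal.inner hf.measurable).aestronglyMeasurable)
    (Filter.Eventually.of_forall fun x => ?_)
  exact (norm_inner_le_norm _ _).trans
    (mul_le_mul_of_nonneg_right (D.norm_normal_le x) (norm_nonneg _))

/-! ### The Sobolev space `H¹(Ω)` and `H^div(Ω)` -/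

lemma integrable_clm_apply {F : Type*} [NormedAddCommGroup F] [NormedSpace ℝ F]
    {A : Euc (d + 1) → F →L[ℝ] ℝ} (hA : Continuous A) (hA' : HasCompactSupport A)
    (f : Lp F 2 ((volume : Measure (Euc (d + 1))).restrict D.carrier)) :
    Integrable (fun x => A x (f x)) ((volume : Measure (Euc (d + 1))).restrict D.carrier) := by
  obtain ⟨C, hC⟩ := hA'.exists_bound_of_continuous hA
  have hf : Integrable f ((volume : Measure (Euc (d + 1))).restrict D.carrier) :=
    (Lp.memLp f).integrable (by norm_num)
  refine (hf.norm.const_mul C).mono' ?_ (Filter.Eventually.of_forall fun x => ?_)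
  · exact isBoundedBilinearMap_apply.continuous.comp_aestronglyMeasurable
      (hA.aestronglyMeasurable.prodMk hf.aestronglyMeasurable)
  · exact ((A x).le_opNorm _).trans (mul_le_mul_of_nonneg_right (hC x) (norm_nonneg _))

lemma _root_.IsTestFunction.continuous_fderiv {n : ℕ} {Ω : Set (Euc n)} {ψ : Euc n → ℝ}
    (hψ : IsTestFunction Ω ψ) : Continuous (fderiv ℝ ψ) :=
  hψ.1.continuous_fderiv (by simp)

lemma integrable_mul_fderiv {ψ : Euc (d + 1) → ℝ} (hψ : IsTestFunction D.carrier ψ)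
    (u : D.L2) (e : Euc (d + 1)) :
    Integrable (fun x => u x * fderiv ℝ ψ x e)
      ((volume : Measure (Euc (d + 1))).restrict D.carrier) := by
  have h := D.integrable_clm_apply (F := ℝ)
    (A := fun x => (fderiv ℝ ψ x e) • ContinuousLinearMap.id ℝ ℝ)
    ((hψ.continuous_fderiv.clm_apply continuous_const).smul continuous_const)
    ((hψ.2.1.fderiv ℝ).mono' (fun x hx => subset_tsupport _ (fun h0 => hx (by simp [h0])))) u
  refine h.congr (Filter.Eventually.of_forall fun x => ?_)
  simp [mul_comm]

lemma integrable_inner_mul {ψ : Euc (d + 1) → ℝ} (hψ : IsTestFunction D.carrier ψ)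
    (v : D.L2Vec) (e : Euc (d + 1)) :
    Integrable (fun x => ⟪v x, e⟫_ℝ * ψ x)
      ((volume : Measure (Euc (d + 1))).restrict D.carrier) := by
  have h := D.integrable_clm_apply
    (A := fun x => ψ x • innerSL ℝ e)
    (hψ.1.continuous.smul continuous_const)
    (hψ.2.1.mono' (fun x hx => subset_tsupport _ (fun h0 => hx (by simp [h0])))) v
  refine h.congr (Filter.Eventually.of_forall fun x => ?_)
  simp [mul_comm, real_inner_comm]

lemma integrable_mul {ψ : Euc (d + 1) → ℝ} (hψ : IsTestFunction D.carrier ψ) (g : D.L2) :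
    Integrable (fun x => g x * ψ x)
      ((volume : Measure (Euc (d + 1))).restrict D.carrier) := by
  have h := D.integrable_clm_apply (F := ℝ)
    (A := fun x => ψ x • ContinuousLinearMap.id ℝ ℝ)
    (hψ.1.continuous.smul continuous_const)
    (hψ.2.1.mono' (fun x hx => subset_tsupport _ (fun h0 => hx (by simp [h0])))) g
  refine h.congr (Filter.Eventually.of_forall fun x => ?_)
  simp [mul_comm]

lemma integrable_fderiv_apply {ψ : Euc (d + 1) → ℝ} (hψ : IsTestFunction D.carrier ψ)
    (f : D.L2Vec) :
    Integrable (fun x => fderiv ℝ ψ x (f x))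
      ((volume : Measure (Euc (d + 1))).restrict D.carrier) :=
  D.integrable_clm_apply hψ.continuous_fderiv (hψ.2.1.fderiv ℝ) f

/-- `H¹(Ω)` as a subspace: the pairs `(u, ∇u)` in `L²(Ω) × L²(Ω)ⁿ`, with the graph norm of the gradient. -/
def H1Submodule : Submodule ℝ (WithLp 2 (D.L2 × D.L2Vec)) where
  carrier := {p | HasWeakGradient D.carrier p.fst p.snd}
  add_mem' := by
    intro p q hp hq ψ hψ e
    have h1 : ∫ x in D.carrier, (p + q).fst x * fderiv ℝ ψ x e
        = ∫ x in D.carrier, (p.fst x * fderiv ℝ ψ x e + q.fst x * fderiv ℝ ψ x e) := by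
      refine integral_congr_ae ?_
      filter_upwards [Lp.coeFn_add p.fst q.fst] with x hx
      rw [WithLp.add_fst, hx, Pi.add_apply, add_mul]
    have h2 : ∫ x in D.carrier, ⟪(p + q).snd x, e⟫_ℝ * ψ x
        = ∫ x in D.carrier, (⟪p.snd x, e⟫_ℝ * ψ x + ⟪q.snd x, e⟫_ℝ * ψ x) := by
      refine integral_congr_ae ?_
      filter_upwards [Lp.coeFn_add p.snd q.snd] with x hx
      rw [WithLp.add_snd, hx, Pi.add_apply, inner_add_left, add_mul]
    rw [h1, h2, integral_add (D.integrable_mul_fderiv hψ _ e) (D.integrable_mul_fderiv hψ _ e),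
      integral_add (D.integrable_inner_mul hψ _ e) (D.integrable_inner_mul hψ _ e),
      hp ψ hψ e, hq ψ hψ e, neg_add]
  zero_mem' := by
    intro ψ hψ e
    have h1 : ∫ x in D.carrier, (0 : WithLp 2 (D.L2 × D.L2Vec)).fst x * fderiv ℝ ψ x e = 0 := by
      refine integral_eq_zero_of_ae ?_
      filter_upwards [Lp.coeFn_zero ℝ 2 (volume.restrict D.carrier)] with x hx
      rw [WithLp.zero_fst, hx]; simp
    have h2 : ∫ x in D.carrier, ⟪(0 : WithLp 2 (D.L2 × D.L2Vec)).snd x, e⟫_ℝ * ψ x = 0 := by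
      refine integral_eq_zero_of_ae ?_
      filter_upwards [Lp.coeFn_zero (Euc (d + 1)) 2 (volume.restrict D.carrier)] with x hx
      rw [WithLp.zero_snd, hx]; simp
    rw [h1, h2, neg_zero]
  smul_mem' := by
    intro c p hp ψ hψ e
    have h1 : ∫ x in D.carrier, (c • p).fst x * fderiv ℝ ψ x e
        = ∫ x in D.carrier, c * (p.fst x * fderiv ℝ ψ x e) := by
      refine integral_congr_ae ?_
      filter_upwards [Lp.coeFn_smul c p.fst] with x hx
      rw [WithLp.smul_fst, hx, Pi.smul_apply, smul_eq_mul, mul_assoc]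
    have h2 : ∫ x in D.carrier, ⟪(c • p).snd x, e⟫_ℝ * ψ x
        = ∫ x in D.carrier, c * (⟪p.snd x, e⟫_ℝ * ψ x) := by
      refine integral_congr_ae ?_
      filter_upwards [Lp.coeFn_smul c p.snd] with x hx
      rw [WithLp.smul_snd, hx, Pi.smul_apply, real_inner_smul_left, mul_assoc]
    rw [h1, h2, integral_const_mul, integral_const_mul, hp ψ hψ e, mul_neg]

/-- `H^div(Ω)` as a subspace: the pairs `(f, div f)` in `L²(Ω)ⁿ × L²(Ω)`, with the graph norm of the
divergence. -/
def HdivSubmodule : Submodule ℝ (WithLp 2 (D.L2Vec × D.L2)) where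
  carrier := {p | HasWeakDivergence D.carrier p.fst p.snd}
  add_mem' := by
    intro p q hp hq ψ hψ
    have h1 : ∫ x in D.carrier, fderiv ℝ ψ x ((p + q).fst x)
        = ∫ x in D.carrier, (fderiv ℝ ψ x (p.fst x) + fderiv ℝ ψ x (q.fst x)) := by
      refine integral_congr_ae ?_
      filter_upwards [Lp.coeFn_add p.fst q.fst] with x hx
      rw [WithLp.add_fst, hx, Pi.add_apply, map_add]
    have h2 : ∫ x in D.carrier, (p + q).snd x * ψ x
        = ∫ x in D.carrier, (p.snd x * ψ x + q.snd x * ψ x) := by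
      refine integral_congr_ae ?_
      filter_upwards [Lp.coeFn_add p.snd q.snd] with x hx
      rw [WithLp.add_snd, hx, Pi.add_apply, add_mul]
    rw [h1, h2, integral_add (D.integrable_fderiv_apply hψ _) (D.integrable_fderiv_apply hψ _),
      integral_add (D.integrable_mul hψ _) (D.integrable_mul hψ _), hp ψ hψ, hq ψ hψ, neg_add]
  zero_mem' := by
    intro ψ hψ
    have h1 : ∫ x in D.carrier, fderiv ℝ ψ x ((0 : WithLp 2 (D.L2Vec × D.L2)).fst x) = 0 := by
      refine integral_eq_zero_of_ae ?_
      filter_upwards [Lp.coeFn_zero (Euc (d + 1)) 2 (volume.restrict D.carrier)] with x hx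
      rw [WithLp.zero_fst, hx]; simp
    have h2 : ∫ x in D.carrier, (0 : WithLp 2 (D.L2Vec × D.L2)).snd x * ψ x = 0 := by
      refine integral_eq_zero_of_ae ?_
      filter_upwards [Lp.coeFn_zero ℝ 2 (volume.restrict D.carrier)] with x hx
      rw [WithLp.zero_snd, hx]; simp
    rw [h1, h2, neg_zero]
  smul_mem' := by
    intro c p hp ψ hψ
    have h1 : ∫ x in D.carrier, fderiv ℝ ψ x ((c • p).fst x)
        = ∫ x in D.carrier, c * fderiv ℝ ψ x (p.fst x) := by
      refine integral_congr_ae ?_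
      filter_upwards [Lp.coeFn_smul c p.fst] with x hx
      rw [WithLp.smul_fst, hx, Pi.smul_apply, map_smul, smul_eq_mul]
    have h2 : ∫ x in D.carrier, (c • p).snd x * ψ x
        = ∫ x in D.carrier, c * (p.snd x * ψ x) := by
      refine integral_congr_ae ?_
      filter_upwards [Lp.coeFn_smul c p.snd] with x hx
      rw [WithLp.smul_snd, hx, Pi.smul_apply, smul_eq_mul, mul_assoc]
    rw [h1, h2, integral_const_mul, integral_const_mul, hp ψ hψ, mul_neg]

/-- The Sobolev space `H¹(Ω)`. -/
def H1 : Type := D.H1Submodule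

/-- The space `H^div(Ω)`. -/
def Hdiv : Type := D.HdivSubmodule

instance : NormedAddCommGroup D.H1 := inferInstanceAs (NormedAddCommGroup D.H1Submodule)

instance : InnerProductSpace ℝ D.H1 := inferInstanceAs (InnerProductSpace ℝ D.H1Submodule)

instance : NormedAddCommGroup D.Hdiv := inferInstanceAs (NormedAddCommGroup D.HdivSubmodule)

instance : InnerProductSpace ℝ D.Hdiv := inferInstanceAs (InnerProductSpace ℝ D.HdivSubmodule)

/-- The isometric embedding `u ↦ (u, ∇u)` of `H¹(Ω)` into `L²(Ω) × L²(Ω)ⁿ`. -/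
def H1.graph : D.H1 →L[ℝ] WithLp 2 (D.L2 × D.L2Vec) := D.H1Submodule.subtypeL

/-- The isometric embedding `f ↦ (f, div f)` of `H^div(Ω)` into `L²(Ω)ⁿ × L²(Ω)`. -/
def Hdiv.graph : D.Hdiv →L[ℝ] WithLp 2 (D.L2Vec × D.L2) := D.HdivSubmodule.subtypeL

/-- The inclusion `H¹(Ω) → L²(Ω)`. -/
def H1.toL2 : D.H1 →L[ℝ] D.L2 := (WithLp.fstL 2 ℝ D.L2 D.L2Vec).comp (H1.graph D)

/-- The gradient `∇ : H¹(Ω) → L²(Ω)ⁿ`. -/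
def H1.grad : D.H1 →L[ℝ] D.L2Vec := (WithLp.sndL 2 ℝ D.L2 D.L2Vec).comp (H1.graph D)

/-- The inclusion `H^div(Ω) → L²(Ω)ⁿ`. -/
def Hdiv.toL2Vec : D.Hdiv →L[ℝ] D.L2Vec := (WithLp.fstL 2 ℝ D.L2Vec D.L2).comp (Hdiv.graph D)

/-- The divergence `div : H^div(Ω) → L²(Ω)`. -/
def Hdiv.div : D.Hdiv →L[ℝ] D.L2 := (WithLp.sndL 2 ℝ D.L2Vec D.L2).comp (Hdiv.graph D)

/-! ### Smooth functions and fields as elements of `H¹(Ω)` and `H^div(Ω)` -/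

lemma integral_mul_fderiv {φ ψ : Euc (d + 1) → ℝ} (hφ : ContDiff ℝ ∞ φ)
    (hψ : IsTestFunction D.carrier ψ) (e : Euc (d + 1)) :
    ∫ x in D.carrier, φ x * fderiv ℝ ψ x e = -∫ x in D.carrier, fderiv ℝ φ x e * ψ x := by
  have hdφ : Continuous (fderiv ℝ φ) := hφ.continuous_fderiv (by simp)
  have hdψ := hψ.continuous_fderiv
  have hc : HasCompactSupport fun x => fderiv ℝ ψ x e := hψ.2.1.fderiv_apply ℝ e
  have hz : ∀ x, x ∉ D.carrier → ψ x = 0 := fun x hx =>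
    image_eq_zero_of_notMem_tsupport fun h => hx (hψ.2.2 h)
  have hz' : ∀ x, x ∉ D.carrier → fderiv ℝ ψ x e = 0 := fun x hx => by
    rw [image_eq_zero_of_notMem_tsupport (f := fderiv ℝ ψ)
      fun h => hx (hψ.2.2 (tsupport_fderiv_subset ℝ h))]
    simp
  rw [setIntegral_eq_integral_of_forall_compl_eq_zero (fun x hx => by rw [hz' x hx, mul_zero]),
    setIntegral_eq_integral_of_forall_compl_eq_zero (fun x hx => by rw [hz x hx, mul_zero])]
  refine integral_mul_fderiv_eq_neg_fderiv_mul_of_integrable ?_ ?_ ?_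
    (fun x _ => (hφ.differentiable (by simp)).differentiableAt)
    (fun x _ => (hψ.1.differentiable (by simp)).differentiableAt)
  · exact ((hdφ.clm_apply continuous_const).mul hψ.1.continuous).integrable_of_hasCompactSupport
      hψ.2.1.mul_left
  · exact (hφ.continuous.mul (hdψ.clm_apply continuous_const)).integrable_of_hasCompactSupport
      hc.mul_left
  · exact (hφ.continuous.mul hψ.1.continuous).integrable_of_hasCompactSupport hψ.2.1.mul_left

lemma continuous_gradient {φ : Euc (d + 1) → ℝ} (hφ : ContDiff ℝ ∞ φ) :
    Continuous (gradient φ) := by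
  unfold gradient
  exact (InnerProductSpace.toDual ℝ (Euc (d + 1))).symm.continuous.comp
    (hφ.continuous_fderiv (by simp))

lemma continuous_divergence {f : Euc (d + 1) → Euc (d + 1)} (hf : ContDiff ℝ ∞ f) :
    Continuous (divergence f) := by
  unfold divergence
  have h : Continuous (fderiv ℝ f) := hf.continuous_fderiv (by simp)
  fun_prop

/-- A function in `C^∞(closure Ω)` as an element of `H¹(Ω)`. -/
def smoothToH1Submodule : smoothFunctions (d + 1) ℝ →ₗ[ℝ] D.H1Submodule where
  toFun φ := ⟨WithLp.toLp 2
      ((D.memLp_carrier ((contDiff_of_smooth φ).continuous)).toLp φ.1,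
        (D.memLp_carrier (continuous_gradient (contDiff_of_smooth φ))).toLp (gradient φ.1)), by
    intro ψ hψ e
    have h1 : ∫ x in D.carrier, (D.memLp_carrier ((contDiff_of_smooth φ).continuous)).toLp φ.1 x *
        fderiv ℝ ψ x e = ∫ x in D.carrier, φ.1 x * fderiv ℝ ψ x e := by
      refine integral_congr_ae ?_
      filter_upwards [(D.memLp_carrier ((contDiff_of_smooth φ).continuous)).coeFn_toLp] with x hx
      rw [hx]
    have h2 : ∫ x in D.carrier,
        ⟪(D.memLp_carrier (continuous_gradient (contDiff_of_smooth φ))).toLp (gradient φ.1) x, e⟫_ℝ * ψ x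
        = ∫ x in D.carrier, fderiv ℝ φ.1 x e * ψ x := by
      refine integral_congr_ae ?_
      filter_upwards [(D.memLp_carrier (continuous_gradient (contDiff_of_smooth φ))).coeFn_toLp] with x hx
      rw [hx, gradient, InnerProductSpace.toDual_symm_apply]
    exact h1.trans ((D.integral_mul_fderiv (contDiff_of_smooth φ) hψ e).trans (congrArg Neg.neg h2.symm))⟩
  map_add' φ χ := by
    have hd : gradient (φ.1 + χ.1) = gradient φ.1 + gradient χ.1 := by
      funext x
      simp only [gradient, Pi.add_apply]
      rw [fderiv_add ((contDiff_of_smooth φ).differentiable (by simp)).differentiableAt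
        ((contDiff_of_smooth χ).differentiable (by simp)).differentiableAt, map_add]
    refine Subtype.ext ?_
    simp only [Submodule.coe_add, hd]
    rfl
  map_smul' c φ := by
    have hd : gradient (c • φ.1) = c • gradient φ.1 := by
      funext x
      simp only [gradient, Pi.smul_apply]
      rw [fderiv_const_smul ((contDiff_of_smooth φ).differentiable (by simp)).differentiableAt]
      simp
    refine Subtype.ext ?_
    simp only [Submodule.coe_smul, hd]
    rfl

/-- A field in `C^∞(closure Ω)ⁿ` as an element of `H^div(Ω)`. -/
def smoothToHdivSubmodule : smoothFunctions (d + 1) (Euc (d + 1)) →ₗ[ℝ] D.HdivSubmodule where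
  toFun f := ⟨WithLp.toLp 2
      ((D.memLp_carrier ((contDiff_of_smooth f).continuous)).toLp f.1,
        (D.memLp_carrier (continuous_divergence (contDiff_of_smooth f))).toLp (divergence f.1)), by
    intro ψ hψ
    have hf : ∀ i, ContDiff ℝ ∞ fun x => f.1 x i := fun i => contDiff_euclidean.1 (contDiff_of_smooth f) i
    have hfd : ∀ x i, fderiv ℝ (fun y => f.1 y i) x (EuclideanSpace.single i 1)
        = fderiv ℝ f.1 x (EuclideanSpace.single i 1) i := fun x i => by
      have h := ((EuclideanSpace.proj (𝕜 := ℝ) i).hasFDerivAt.comp x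
        ((contDiff_of_smooth f).differentiable (by simp)).differentiableAt.hasFDerivAt).fderiv
      have h' : ((EuclideanSpace.proj (𝕜 := ℝ) i) ∘ f.1) = fun y => f.1 y i := rfl
      rw [h'] at h
      rw [h]; rfl
    have hexp : ∀ x, fderiv ℝ ψ x (f.1 x)
        = ∑ i, f.1 x i * fderiv ℝ ψ x (EuclideanSpace.single i 1) := fun x => by
      conv_lhs => rw [← (EuclideanSpace.basisFun (Fin (d + 1)) ℝ).sum_repr (f.1 x)]
      simp
    have hi1 : ∀ i, Integrable (fun x => f.1 x i * fderiv ℝ ψ x (EuclideanSpace.single i 1))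
        (volume.restrict D.carrier) := fun i =>
      (((hf i).continuous.mul (hψ.continuous_fderiv.clm_apply
        continuous_const)).integrable_of_hasCompactSupport
          (hψ.2.1.fderiv_apply ℝ _).mul_left).integrableOn
    have hi2 : ∀ i, Integrable
        (fun x => fderiv ℝ (fun y => f.1 y i) x (EuclideanSpace.single i 1) * ψ x)
        (volume.restrict D.carrier) := fun i =>
      (((((hf i).continuous_fderiv (by simp)).clm_apply continuous_const).mul
        hψ.1.continuous).integrable_of_hasCompactSupport hψ.2.1.mul_left).integrableOn
    have h1 : ∫ x in D.carrier,
        fderiv ℝ ψ x ((D.memLp_carrier ((contDiff_of_smooth f).continuous)).toLp f.1 x)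
        = ∑ i, ∫ x in D.carrier, f.1 x i * fderiv ℝ ψ x (EuclideanSpace.single i 1) := by
      rw [← integral_finsetSum _ fun i _ => hi1 i]
      refine integral_congr_ae ?_
      filter_upwards [(D.memLp_carrier ((contDiff_of_smooth f).continuous)).coeFn_toLp] with x hx
      rw [hx, hexp]
    have h2 : ∫ x in D.carrier,
        (D.memLp_carrier (continuous_divergence (contDiff_of_smooth f))).toLp (divergence f.1) x * ψ x
        = ∑ i, ∫ x in D.carrier,
          fderiv ℝ (fun y => f.1 y i) x (EuclideanSpace.single i 1) * ψ x := by
      rw [← integral_finsetSum _ fun i _ => hi2 i]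
      refine integral_congr_ae ?_
      filter_upwards [(D.memLp_carrier (continuous_divergence (contDiff_of_smooth f))).coeFn_toLp] with x hx
      rw [hx, divergence, Finset.sum_mul]
      exact Finset.sum_congr rfl fun i _ => by rw [hfd]
    refine h1.trans (Eq.trans ?_ (congrArg Neg.neg h2.symm))
    rw [← Finset.sum_neg_distrib]
    exact Finset.sum_congr rfl fun i _ => D.integral_mul_fderiv (hf i) hψ _⟩
  map_add' f g := by
    have hd : divergence (f.1 + g.1) = divergence f.1 + divergence g.1 := by
      funext x
      simp only [divergence, Pi.add_apply]
      rw [fderiv_add ((contDiff_of_smooth f).differentiable (by simp)).differentiableAt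
        ((contDiff_of_smooth g).differentiable (by simp)).differentiableAt, ← Finset.sum_add_distrib]
      rfl
    refine Subtype.ext ?_
    simp only [Submodule.coe_add, hd]
    rfl
  map_smul' c f := by
    have hd : divergence (c • f.1) = c • divergence f.1 := by
      funext x
      simp only [divergence, Pi.smul_apply]
      rw [fderiv_const_smul ((contDiff_of_smooth f).differentiable (by simp)).differentiableAt,
        Finset.smul_sum]
      rfl
    refine Subtype.ext ?_
    simp only [Submodule.coe_smul, hd]
    rfl

/-- The inclusion `C^∞(closure Ω) → H¹(Ω)`. -/
def smoothToH1 : smoothFunctions (d + 1) ℝ →ₗ[ℝ] D.H1 := D.smoothToH1Submodule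

/-- The inclusion `C^∞(closure Ω)ⁿ → H^div(Ω)`. -/
def smoothToHdiv : smoothFunctions (d + 1) (Euc (d + 1)) →ₗ[ℝ] D.Hdiv := D.smoothToHdivSubmodule

/-! ### The Dirichlet trace and `H^{1/2}(∂Ω)` -/

/-- The restriction `φ ↦ φ|_∂Ω` of smooth functions to the boundary. -/
def smoothTrace : smoothFunctions (d + 1) ℝ →ₗ[ℝ] D.L2Boundary where
  toFun φ := (D.memLp_boundary ((contDiff_of_smooth φ).continuous)).toLp φ.1
  map_add' _ _ := rfl
  map_smul' _ _ := rfl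

/-- The Dirichlet trace `γ₀ : H¹(Ω) → L²(∂Ω)`, the continuous extension of `φ ↦ φ|_∂Ω`. -/
def dirichletTrace : D.H1 →L[ℝ] D.L2Boundary := D.smoothTrace.extendOfNorm D.smoothToH1

/-- `H^{1/2}(∂Ω)`: the range of the Dirichlet trace on `H¹(Ω)` with the norm
`‖h‖ = inf {‖u‖ : γ₀ u = h}`, realised as the quotient `H¹(Ω) / ker γ₀`. The boundary function
belonging to an element `h` is `HHalf.toL2 h`. -/
def HHalf : Type := D.H1 ⧸ LinearMap.ker D.dirichletTrace.toLinearMap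

instance : IsClosed (LinearMap.ker D.dirichletTrace.toLinearMap : Set D.H1) :=
  D.dirichletTrace.isClosed_ker

instance : NormedAddCommGroup D.HHalf :=
  inferInstanceAs (NormedAddCommGroup (D.H1 ⧸ LinearMap.ker D.dirichletTrace.toLinearMap))

instance : NormedSpace ℝ D.HHalf :=
  inferInstanceAs (NormedSpace ℝ (D.H1 ⧸ LinearMap.ker D.dirichletTrace.toLinearMap))

/-- The Dirichlet trace as a map onto `H^{1/2}(∂Ω)`. -/
def traceHHalf : D.H1 →L[ℝ] D.HHalf :=
  LinearMap.mkContinuous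
    ((LinearMap.ker D.dirichletTrace.toLinearMap).mkQ : D.H1 →ₗ[ℝ] D.HHalf) 1 (fun u => by
      rw [one_mul]
      exact Submodule.Quotient.norm_mk_le _ u)

lemma exists_traceHHalf_eq (h : D.HHalf) {δ : ℝ} (hδ : 0 < δ) :
    ∃ u : D.H1, D.traceHHalf u = h ∧ ‖u‖ < ‖h‖ + δ :=
  Submodule.Quotient.norm_mk_lt (S := LinearMap.ker D.dirichletTrace.toLinearMap) h hδ

/-- The embedding `H^{1/2}(∂Ω) → L²(∂Ω)` as a linear map. -/
def HHalf.toL2Linear : D.HHalf →ₗ[ℝ] D.L2Boundary :=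
  (LinearMap.ker D.dirichletTrace.toLinearMap).liftQ D.dirichletTrace.toLinearMap le_rfl

/-- The embedding `H^{1/2}(∂Ω) → L²(∂Ω)`. -/
def HHalf.toL2 : D.HHalf →L[ℝ] D.L2Boundary :=
  LinearMap.mkContinuous (HHalf.toL2Linear D) ‖D.dirichletTrace‖ (fun h => by
    refine le_of_forall_pos_le_add fun ε hε => ?_
    obtain ⟨δ, hδ, hδε⟩ : ∃ δ > 0, ‖D.dirichletTrace‖ * δ ≤ ε :=
      ⟨ε / (‖D.dirichletTrace‖ + 1), by positivity, by
        rw [mul_div_assoc', div_le_iff₀ (by positivity)]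
        nlinarith [norm_nonneg D.dirichletTrace]⟩
    obtain ⟨u, hu, hn⟩ := D.exists_traceHHalf_eq h hδ
    have h1 : HHalf.toL2Linear D h = D.dirichletTrace u := by rw [← hu]; rfl
    rw [h1]
    calc ‖D.dirichletTrace u‖ ≤ ‖D.dirichletTrace‖ * ‖u‖ := D.dirichletTrace.le_opNorm u
      _ ≤ ‖D.dirichletTrace‖ * (‖h‖ + δ) := by gcongr
      _ ≤ _ := by rw [mul_add]; exact add_le_add_right hδε _)

lemma HHalf.toL2_traceHHalf (u : D.H1) :
    HHalf.toL2 D (D.traceHHalf u) = D.dirichletTrace u := rfl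

lemma HHalf.toL2_injective : Function.Injective (HHalf.toL2 D) :=
  LinearMap.ker_eq_bot.1 (Submodule.ker_liftQ_eq_bot
    (LinearMap.ker D.dirichletTrace.toLinearMap) D.dirichletTrace.toLinearMap le_rfl le_rfl)

/-! ### The splitting of the boundary, `H¹_{Γ₀}(Ω)` and `𝒲` -/

/-- `Γ₀` and `Γ₁` split the boundary: they are disjoint relatively open subsets of the boundary,
whose closures cover it, and whose boundaries within it have surface measure zero. -/
structure IsSplitting (Γ₀ Γ₁ : Set (Euc (d + 1))) : Prop where
  relOpen₀ : ∃ O, IsOpen O ∧ Γ₀ = O ∩ frontier D.carrier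
  relOpen₁ : ∃ O, IsOpen O ∧ Γ₁ = O ∩ frontier D.carrier
  disjoint : Disjoint Γ₀ Γ₁
  cover : closure Γ₀ ∪ closure Γ₁ = frontier D.carrier
  null₀ : D.surfaceMeasure (closure Γ₀ \ Γ₀) = 0
  null₁ : D.surfaceMeasure (closure Γ₁ \ Γ₁) = 0

variable (Γ₀ Γ₁ : Set (Euc (d + 1)))

/-- `H¹_{Γ₀}(Ω)` as a subspace: the `u ∈ H¹(Ω)` with `u|_{Γ₀} = 0`. -/
def E0Submodule : Submodule ℝ D.H1 :=
  LinearMap.ker ((D.restrictTo Γ₀).comp D.dirichletTrace).toLinearMap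

/-- `𝒲` as a subspace: the `h ∈ H^{1/2}(∂Ω)` with `h|_{Γ₀} = 0`. -/
def WSubmodule : Submodule ℝ D.HHalf :=
  LinearMap.ker ((D.restrictTo Γ₀).comp (HHalf.toL2 D)).toLinearMap

/-- `E₀ = H¹_{Γ₀}(Ω)`, with the norm inherited from `H¹(Ω)`. -/
def E0 : Type := D.E0Submodule Γ₀

/-- `𝒲`, with the norm inherited from `H^{1/2}(∂Ω)`. -/
def W : Type := D.WSubmodule Γ₀

instance : NormedAddCommGroup (D.E0 Γ₀) :=
  inferInstanceAs (NormedAddCommGroup (D.E0Submodule Γ₀))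

instance : InnerProductSpace ℝ (D.E0 Γ₀) :=
  inferInstanceAs (InnerProductSpace ℝ (D.E0Submodule Γ₀))

instance : NormedAddCommGroup (D.W Γ₀) :=
  inferInstanceAs (NormedAddCommGroup (D.WSubmodule Γ₀))

instance : NormedSpace ℝ (D.W Γ₀) := inferInstanceAs (NormedSpace ℝ (D.WSubmodule Γ₀))

/-- The inclusion `E₀ → H¹(Ω)`. -/
def E0.toH1 : D.E0 Γ₀ →L[ℝ] D.H1 := (D.E0Submodule Γ₀).subtypeL

/-- The inclusion `𝒲 → H^{1/2}(∂Ω)`. -/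
def W.toHHalf : D.W Γ₀ →L[ℝ] D.HHalf := (D.WSubmodule Γ₀).subtypeL

/-- The map `h ↦ h|_{Γ₁}` from `𝒲` to `L²(Γ₁)`. -/
def WtoU : D.W Γ₀ →L[ℝ] D.L2Part Γ₁ :=
  ((D.restrictTo Γ₁).comp (HHalf.toL2 D)).comp (W.toHHalf D Γ₀)

/-- `L²(Γ₁) → 𝒲'`, where `𝒲'` is the dual of `𝒲` with pivot space `L²(Γ₁)`. -/
def UtoWdual : D.L2Part Γ₁ →L[ℝ] StrongDual ℝ (D.W Γ₀) := pivotDual (D.WtoU Γ₀ Γ₁)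

/-- `L²(Ω) → E₀'`, where `E₀'` is the dual of `E₀` with pivot space `L²(Ω)`. -/
def L2toE0dual : D.L2 →L[ℝ] StrongDual ℝ (D.E0 Γ₀) :=
  pivotDual ((H1.toL2 D).comp (E0.toH1 D Γ₀))

/-! ### The normal trace -/

/-- The map `f ↦ (ν · f)|_{Γ₁}` on smooth fields. -/
def smoothNormalTrace : smoothFunctions (d + 1) (Euc (d + 1)) →ₗ[ℝ] D.L2Part Γ₁ where
  toFun f := D.restrictTo Γ₁ ((D.memLp_normal_inner ((contDiff_of_smooth f).continuous)).toLp
    fun x => ⟪D.normal x, f.1 x⟫_ℝ)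
  map_add' f g := by
    rw [← map_add, ← MemLp.toLp_add]
    congr 1
    refine MemLp.toLp_congr _ _ (Filter.Eventually.of_forall fun x => ?_)
    simp [inner_add_right]
  map_smul' c f := by
    rw [← map_smul, ← MemLp.toLp_const_smul]
    congr 1
    refine MemLp.toLp_congr _ _ (Filter.Eventually.of_forall fun x => ?_)
    simp [inner_smul_right]

/-- The normal trace `γ_⊥ : H^div(Ω) → 𝒲'`, the continuous extension of `f ↦ (ν · f)|_{Γ₁}`. -/
def normalTrace : D.Hdiv →L[ℝ] StrongDual ℝ (D.W Γ₀) :=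
  LinearMap.extendOfNorm
    ((D.UtoWdual Γ₀ Γ₁).toLinearMap ∘ₗ D.smoothNormalTrace Γ₁) D.smoothToHdiv

/-! ### The operators of the wave equation -/

/-- `L = -∇ : E₀ → L²(Ω)ⁿ`. -/
def L : D.E0 Γ₀ →L[ℝ] D.L2Vec := -(H1.grad D).comp (E0.toH1 D Γ₀)

/-- `L' : L²(Ω)ⁿ → E₀'`. -/
def Ldual : D.L2Vec →L[ℝ] StrongDual ℝ (D.E0 Γ₀) := pivotDual (D.L Γ₀)

/-- `K₀ = γ₀|_{E₀} : E₀ → L²(Γ₁)`. -/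
def K0 : D.E0 Γ₀ →L[ℝ] D.L2Part Γ₁ :=
  ((D.restrictTo Γ₁).comp D.dirichletTrace).comp (E0.toH1 D Γ₀)

/-- The dual `K₀' : L²(Γ₁) → E₀'` of `K₀`. -/
def K0dual : D.L2Part Γ₁ →L[ℝ] StrongDual ℝ (D.E0 Γ₀) := pivotDual (D.K0 Γ₀ Γ₁)

/-- `γ₀|_{E₀}` as an operator `E₀ → 𝒲`. -/
def K0W : D.E0 Γ₀ →L[ℝ] D.W Γ₀ :=
  (D.traceHHalf.comp (E0.toH1 D Γ₀)).codRestrict (D.WSubmodule Γ₀) fun u => u.2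

/-- The dual `K₀' : 𝒲' → E₀'` of `γ₀|_{E₀} : E₀ → 𝒲`. -/
def K0Wdual : StrongDual ℝ (D.W Γ₀) →L[ℝ] StrongDual ℝ (D.E0 Γ₀) := boundedDual (D.K0W Γ₀)

end LipschitzDomain

end

/-! Everything rests on Green's formula `⟨γ_⊥ f, γ₀ u⟩ = (div f, u) + (f, ∇u)` for `f ∈ H^div(Ω)`
and `u ∈ E₀` (`IsSplitting.normalTrace_K0W`). Since `L = -∇`, this formula is the identity `L' f =
div f - K₀' γ_⊥ f` tested against `u`.

For smooth `f` and `u` Green's formula follows from the Gauss-Green formula `setIntegral_fderiv`,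
and it passes to the limit once smooth functions are dense and both traces are bounded.

Density: gradient and divergence are both of the form `w ↦ A (Dw)` with a constant linear map `A`,
so one Meyers-Serrin argument (`exists_contDiff_approx`) covers both. A partition of unity localises
to the interior and to the charts, where mollification uses a kernel shifted along the chart's
vertical axis, so that only values from inside `Ω` are averaged.

Gauss-Green: below a Lipschitz graph a volume-preserving shear flattens the boundary. Vertical
derivatives are integrated by the fundamental theorem of calculus, and horizontal ones vanish by
integration by parts for Lipschitz functions. The formula also shows that the charts agree: on an
overlap, two charts represent the same volume integral, so their vector measures `ν σ` coincide, and
`|ν| = 1` recovers both `σ` and `ν` (`graphMeasure_overlap`).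

Bounds: the vertical direction of a chart is uniformly transversal to the boundary, so Gauss-Green
applied to `χ φ²` bounds the Dirichlet trace. The normal trace is bounded by Green's formula itself,
tested with lifts of almost minimal norm.

Injectivity: `E₀ → 𝒲` is onto, so its dual is injective. `U → 𝒲'` is injective because smooth
functions supported away from `Γ₀` already separate `L²(Γ₁)`. On `U`, `K₀'` is the composition of
these two maps. -/

open scoped ENNReal Convolution

/-! ### Mollification in `L²` -/

section Mollification

variable {E : Type*} [NormedAddCommGroup E] [NormedSpace ℝ E] [FiniteDimensional ℝ E]
  [MeasurableSpace E] [BorelSpace E] {μ : Measure E} [μ.IsAddHaarMeasure]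
  {F : Type*} [NormedAddCommGroup F] [NormedSpace ℝ F]

/-- Translations are continuous in `L²`. -/
lemma MeasureTheory.MemLp.exists_eLpNorm_translate_sub_le {h : E → F} (hh : MemLp h 2 μ)
    {ε : ℝ≥0∞} (hε : 0 < ε) :
    ∃ δ > 0, ∀ z, ‖z‖ < δ → eLpNorm (fun x => h (x - z) - h x) 2 μ ≤ ε := by
  have : Fact ((2 : ℝ≥0∞) ≠ ⊤) := ⟨by norm_num⟩
  -- Translations act continuously on `L²` because the exponent is finite. The domain action of `-z`
  -- gives `x ↦ h (-z + x)`.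
  have hc : Continuous fun z : E => DomAddAct.mk (-z) +ᵥ hh.toLp h :=
    (DomAddAct.continuous_mk.comp continuous_neg).vadd continuous_const
  have h0 := Metric.eventually_nhds_iff.1 ((hc.tendsto 0).eventually
    (Metric.eball_mem_nhds _ hε))
  obtain ⟨δ, hδ, H⟩ := h0
  refine ⟨δ, hδ, fun z hz => ?_⟩
  have h1 := H (y := z) (by simpa using hz)
  have e : ∀ z : E, DomAddAct.mk (-z) +ᵥ hh.toLp h =
      (hh.comp_measurePreserving (measurePreserving_vadd (-z) μ)).toLp (fun x => h (-z +ᵥ x)) :=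
    fun z => rfl
  rw [e z, e 0, Lp.edist_toLp_toLp] at h1
  refine (le_of_eq ?_).trans h1.le
  congr 1
  funext x
  simp [sub_eq_neg_add]

/-- `k dμ` is a probability measure, so `k ⋆ h - h` is an average of the differences `h (x - z) - h
x`. Jensen's inequality at each `x`, in the form `L¹ ≤ L²`, and Tonelli bound its `L²` norm by the
largest norm of a difference. -/
lemma eLpNorm_convolution_sub_le [CompleteSpace F] {k : E → ℝ} (hk : Continuous k) (hk0 : ∀ x, 0 ≤ k x)
    (hkc : HasCompactSupport k) (hk1 : ∫ x, k x ∂μ = 1) {h : E → F} (hh : MemLp h 2 μ)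
    {ε : ℝ≥0∞} (hε : ∀ z ∈ Function.support k, eLpNorm (fun x => h (x - z) - h x) 2 μ ≤ ε) :
    eLpNorm (fun x => (k ⋆[ContinuousLinearMap.lsmul ℝ ℝ, μ] h) x - h x) 2 μ ≤ ε := by
  have hki : Integrable k μ := hk.integrable_of_hasCompactSupport hkc
  have hloc : LocallyIntegrable h μ := hh.locallyIntegrable (by norm_num)
  set ν : Measure E := μ.withDensity fun z => ENNReal.ofReal (k z) with hν
  have hkm : Measurable fun z => ENNReal.ofReal (k z) := hk.measurable.ennreal_ofReal
  have hν1 : IsProbabilityMeasure ν := ⟨by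
    rw [hν, withDensity_apply _ MeasurableSet.univ, Measure.restrict_univ,
      ← ofReal_integral_eq_lintegral_ofReal hki (Filter.Eventually.of_forall hk0), hk1,
      ENNReal.ofReal_one]⟩
  have hac : ν ≪ μ := withDensity_absolutelyContinuous _ _
  have hmeas : AEStronglyMeasurable (fun p : E × E => h (p.1 - p.2) - h p.1) (μ.prod ν) := by
    have h1 : AEStronglyMeasurable (fun p : E × E => h (p.1 - p.2)) (μ.prod μ) :=
      hh.1.comp_quasiMeasurePreserving (quasiMeasurePreserving_sub_of_right_invariant μ μ)
    exact (h1.mono_ac (Measure.AbsolutelyContinuous.rfl.prod hac)).sub hh.1.comp_fst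
  have hpt : ∀ x, ‖(k ⋆[ContinuousLinearMap.lsmul ℝ ℝ, μ] h) x - h x‖ₑ ^ 2
      ≤ ∫⁻ z, ‖h (x - z) - h x‖ₑ ^ 2 ∂ν := by
    intro x
    have hx : AEStronglyMeasurable (fun z => h (x - z) - h x) ν :=
      ((hh.1.comp_quasiMeasurePreserving
        (quasiMeasurePreserving_sub_left_of_right_invariant μ x)).mono_ac hac).sub
        aestronglyMeasurable_const
    have e1 : (k ⋆[ContinuousLinearMap.lsmul ℝ ℝ, μ] h) x - h x
        = ∫ z, k z • (h (x - z) - h x) ∂μ := by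
      simp only [smul_sub]
      rw [integral_sub, integral_smul_const, hk1, one_smul, convolution_def]
      · simp
      · exact (hkc.convolutionExists_left (ContinuousLinearMap.lsmul ℝ ℝ) hk hloc x).integrable
      · exact hki.smul_const _
    have e2 : ‖(k ⋆[ContinuousLinearMap.lsmul ℝ ℝ, μ] h) x - h x‖ₑ
        ≤ ∫⁻ z, ‖h (x - z) - h x‖ₑ ∂ν := by
      rw [e1]
      refine (enorm_integral_le_lintegral_enorm _).trans (le_of_eq ?_)
      rw [hν, lintegral_withDensity_eq_lintegral_mul_non_measurable _ hkm
        (Filter.Eventually.of_forall fun _ => ENNReal.ofReal_lt_top)]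
      refine lintegral_congr fun z => ?_
      rw [enorm_smul, Pi.mul_apply, Real.enorm_of_nonneg (hk0 z)]
    have e3 := eLpNorm_le_eLpNorm_of_exponent_le (p := 1) (q := 2) (by norm_num) hx
    rw [eLpNorm_one_eq_lintegral_enorm] at e3
    have e4 := pow_le_pow_left' (e2.trans e3) 2
    refine e4.trans (le_of_eq ?_)
    simpa using eLpNorm_nnreal_pow_eq_lintegral (p := 2) (f := fun z => h (x - z) - h x) (μ := ν)
      (by norm_num)
  have hsq : ∀ (f : E → F), eLpNorm f 2 μ ^ 2 = ∫⁻ x, ‖f x‖ₑ ^ 2 ∂μ := fun f => by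
    simpa using eLpNorm_nnreal_pow_eq_lintegral (p := 2) (f := f) (μ := μ) (by norm_num)
  refine (ENNReal.pow_le_pow_left_iff two_ne_zero).1 ?_
  rw [hsq]
  refine (lintegral_mono hpt).trans ?_
  rw [lintegral_lintegral_swap (hmeas.enorm.pow_const 2)]
  calc ∫⁻ z, ∫⁻ x, ‖h (x - z) - h x‖ₑ ^ 2 ∂μ ∂ν ≤ ∫⁻ _, ε ^ 2 ∂ν := by
        refine lintegral_mono_ae ?_
        have : ∀ᵐ z ∂ν, z ∈ Function.support k := by
          rw [hν, ae_withDensity_iff hkm]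
          exact Filter.Eventually.of_forall fun z hz h0 => hz (by simp [h0])
        filter_upwards [this] with z hz
        rw [← hsq]
        exact pow_le_pow_left' (hε z hz) 2
    _ = ε ^ 2 := by simp

end Mollification

/-! ### First order operators with constant coefficients, in the weak sense -/

section WeakOperator

variable {E : Type*} [NormedAddCommGroup E] [InnerProductSpace ℝ E] [FiniteDimensional ℝ E]
  [MeasurableSpace E] [BorelSpace E]
  {F : Type*} [NormedAddCommGroup F] [NormedSpace ℝ F] [CompleteSpace F]
  {G : Type*} [NormedAddCommGroup G] [NormedSpace ℝ G] [CompleteSpace G]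

/-- `g` is the image of `u` under the first order differential operator `u ↦ A (Du)` on `Ω` in the
sense of distributions. -/
def HasWeakImage (A : (E →L[ℝ] F) →L[ℝ] G) (Ω : Set E) (u : E → F) (g : E → G) : Prop :=
  ∀ ψ : E → ℝ, ContDiff ℝ ∞ ψ → HasCompactSupport ψ → tsupport ψ ⊆ Ω →
    ∫ x in Ω, A ((fderiv ℝ ψ x).smulRight (u x)) = -∫ x in Ω, ψ x • g x

variable {A : (E →L[ℝ] F) →L[ℝ] G} {Ω : Set E} {u : E → F} {g : E → G}

/-- Multiplication of a function by a smooth compactly supported one. -/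
lemma memLp_two_smul {χ : E → ℝ} (hχ : Continuous χ) (hc : HasCompactSupport χ)
    {μ : Measure E} (hu : MemLp u 2 μ) : MemLp (fun y => χ y • u y) 2 μ := by
  obtain ⟨C, hC⟩ := hc.exists_bound_of_continuous hχ
  refine hu.of_le_mul (c := C) (hχ.aestronglyMeasurable.smul hu.1)
    (Filter.Eventually.of_forall fun x => ?_)
  rw [norm_smul]
  exact mul_le_mul_of_nonneg_right (hC x) (norm_nonneg _)

lemma memLp_two_smulRight {B : E → E →L[ℝ] ℝ} (hB : Continuous B) (hc : HasCompactSupport B)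
    {μ : Measure E} (hu : MemLp u 2 μ) : MemLp (fun y => A ((B y).smulRight (u y))) 2 μ := by
  obtain ⟨C, hC⟩ := hc.exists_bound_of_continuous hB
  refine hu.of_le_mul (c := ‖A‖ * C) ?_ (Filter.Eventually.of_forall fun x => ?_)
  · have : Continuous fun p : (E →L[ℝ] ℝ) × F => A (p.1.smulRight p.2) := by
      have := (ContinuousLinearMap.smulRightL ℝ E F).continuous₂
      exact A.continuous.comp this
    exact this.comp_aestronglyMeasurable (hB.aestronglyMeasurable.prodMk hu.1)
  · refine (A.le_opNorm _).trans ?_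
    rw [mul_assoc]
    gcongr
    rw [ContinuousLinearMap.norm_smulRight_apply]
    exact mul_le_mul_of_nonneg_right (hC x) (norm_nonneg _)

/-- If all the translated reflections of the kernel `k` centred in `Ω` meet the support of the
cut-off function `χ` inside `Ω`, then the operator commutes with the convolution with `k`, up to
the derivative of `χ`. -/
lemma HasWeakImage.apply_fderiv_convolution (hw : HasWeakImage A Ω u g) (hΩ : MeasurableSet Ω)
    (hu : MemLp u 2 (volume.restrict Ω)) (hg : MemLp g 2 (volume.restrict Ω)) {χ : E → ℝ}
    (hχ : ContDiff ℝ ∞ χ) (hχc : HasCompactSupport χ) {k : E → ℝ} (hk : ContDiff ℝ ∞ k)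
    (hkc : HasCompactSupport k)
    (hgeom : ∀ x ∈ Ω, ∀ y ∈ tsupport χ, x - y ∈ tsupport k → y ∈ Ω) {x : E} (hx : x ∈ Ω) :
    A (fderiv ℝ (k ⋆[ContinuousLinearMap.lsmul ℝ ℝ, volume] Ω.indicator fun y => χ y • u y) x) =
      (k ⋆[ContinuousLinearMap.lsmul ℝ ℝ, volume] Ω.indicator fun y =>
        χ y • g y + A ((fderiv ℝ χ y).smulRight (u y))) x := by
  have hdχ : Continuous (fderiv ℝ χ) := hχ.continuous_fderiv (by simp)
  have hdk : Continuous (fderiv ℝ k) := hk.continuous_fderiv (by simp)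
  have hχu := memLp_two_smul hχ.continuous hχc hu
  have hχg := memLp_two_smul hχ.continuous hχc hg
  have hdu := memLp_two_smulRight (A := A) hdχ (hχc.fderiv ℝ) hu
  have hloc : LocallyIntegrable (Ω.indicator fun y => χ y • u y) :=
    ((memLp_indicator_iff_restrict hΩ).2 hχu).locallyIntegrable (by norm_num)
  have hsub : Continuous fun y : E => x - y := by fun_prop
  -- The test function for the weak equation is `y ↦ k (x - y) * χ y`. Its support lies in `Ω` by
  -- `hgeom`, and the product rule produces the derivative of the convolution and the commutator
  -- term in `Dχ`.
  have hψ : ContDiff ℝ ∞ fun y => k (x - y) * χ y :=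
    (hk.comp (contDiff_const.sub contDiff_id)).mul hχ
  have hψc : HasCompactSupport fun y => k (x - y) * χ y := hχc.mul_left
  have hψs : tsupport (fun y => k (x - y) * χ y) ⊆ Ω := by
    intro y hy
    have h1 : y ∈ tsupport χ := tsupport_mul_subset_right hy
    refine hgeom x hx y h1 ?_
    have h2 : tsupport (fun y => k (x - y) * χ y) ⊆ (fun y => x - y) ⁻¹' tsupport k := by
      refine closure_minimal (fun z hz => subset_tsupport _ ?_) ((isClosed_tsupport k).preimage hsub)
      intro h0
      exact hz (by simp [h0])
    exact h2 hy
  have hfd : ∀ y, fderiv ℝ (fun y => k (x - y) * χ y) y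
      = k (x - y) • fderiv ℝ χ y - χ y • fderiv ℝ k (x - y) := by
    intro y
    have h1 : HasFDerivAt (fun y => k (x - y)) (-fderiv ℝ k (x - y)) y := by
      have := (hk.differentiable (by simp) (x - y)).hasFDerivAt.comp y
        ((hasFDerivAt_id y).const_sub x)
      simpa [Function.comp_def] using this
    have h2 := (h1.fun_mul (hχ.differentiable (by simp) y).hasFDerivAt).fderiv
    rw [h2]
    simp [sub_eq_add_neg]
  have hfdsR : ∀ y, A ((fderiv ℝ (fun y => k (x - y) * χ y) y).smulRight (u y))
      = k (x - y) • A ((fderiv ℝ χ y).smulRight (u y))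
        - A ((fderiv ℝ k (x - y)).smulRight (χ y • u y)) := by
    intro y
    rw [hfd, ← map_smul, ← map_sub]
    congr 1
    ext v
    simp [sub_smul, smul_smul, mul_comm]
  have hweak := hw _ hψ hψc hψs
  simp only [hfdsR] at hweak
  have hkx : Continuous fun y => k (x - y) := hk.continuous.comp hsub
  have hkxc : HasCompactSupport fun y => k (x - y) :=
    hkc.comp_homeomorph (Homeomorph.subLeft x)
  have bdd : ∀ {H : Type _} [NormedAddCommGroup H] [NormedSpace ℝ H] {f : E → H},
      MemLp f 2 (volume.restrict Ω) → Integrable (fun y => k (x - y) • f y) (volume.restrict Ω) := by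
    intro H _ _ f hf
    have : LocallyIntegrable (Ω.indicator f) :=
      ((memLp_indicator_iff_restrict hΩ).2 hf).locallyIntegrable (by norm_num)
    have h3 := this.integrable_smul_left_of_hasCompactSupport hkx hkxc
    refine (h3.restrict (s := Ω)).congr ?_
    filter_upwards [ae_restrict_mem hΩ] with y hy
    rw [indicator_of_mem hy]
  have hi1 := bdd hdu
  have hi2 := bdd hχg
  have hconv := ((hkc.fderiv ℝ).convolutionExists_left
    ((ContinuousLinearMap.lsmul ℝ ℝ).precompL E) hdk hloc x).integrable_swap
  have hi3 : Integrable (fun y => A ((fderiv ℝ k (x - y)).smulRight (χ y • u y)))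
      (volume.restrict Ω) := by
    refine ((A.integrable_comp hconv).restrict (s := Ω)).congr ?_
    filter_upwards [ae_restrict_mem hΩ] with y hy
    simp only [indicator_of_mem hy]
    congr 1
  rw [integral_sub hi1 hi3] at hweak
  have hL : A (fderiv ℝ (k ⋆[ContinuousLinearMap.lsmul ℝ ℝ, volume] Ω.indicator fun y => χ y • u y) x)
      = ∫ y in Ω, A ((fderiv ℝ k (x - y)).smulRight (χ y • u y)) := by
    rw [(hkc.hasFDerivAt_convolution_left (ContinuousLinearMap.lsmul ℝ ℝ)
      (hk.of_le (by simp)) hloc x).fderiv, convolution_eq_swap, ← integral_indicator hΩ,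
      ← ContinuousLinearMap.integral_comp_comm]
    · refine integral_congr_ae (Filter.Eventually.of_forall fun y => ?_)
      by_cases hy : y ∈ Ω
      · simp only [indicator_of_mem hy]
        congr 1
      · simp [indicator_of_notMem hy]
    · exact hconv
  have hR : (k ⋆[ContinuousLinearMap.lsmul ℝ ℝ, volume] Ω.indicator fun y =>
        χ y • g y + A ((fderiv ℝ χ y).smulRight (u y))) x
      = ∫ y in Ω, (k (x - y) • (χ y • g y) + k (x - y) • A ((fderiv ℝ χ y).smulRight (u y))) := by
    rw [convolution_lsmul_swap, ← integral_indicator hΩ]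
    refine integral_congr_ae (Filter.Eventually.of_forall fun y => ?_)
    by_cases hy : y ∈ Ω
    · simp [indicator_of_mem hy]
    · simp [indicator_of_notMem hy]
  rw [hL, hR, integral_add hi2 hi1]
  simp only [mul_smul] at hweak
  rw [← sub_eq_zero] at hweak ⊢
  rw [← neg_eq_zero, ← hweak]
  abel

/-- Local smooth approximation for the graph norm of the operator. -/
lemma HasWeakImage.exists_contDiff_approx (hw : HasWeakImage A Ω u g) (hΩ : MeasurableSet Ω)
    (hu : MemLp u 2 (volume.restrict Ω)) (hg : MemLp g 2 (volume.restrict Ω)) {χ : E → ℝ}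
    (hχ : ContDiff ℝ ∞ χ) (hχc : HasCompactSupport χ)
    (hker : ∀ δ > 0, ∃ k : E → ℝ, ContDiff ℝ ∞ k ∧ HasCompactSupport k ∧ (∀ x, 0 ≤ k x) ∧
      ∫ x, k x = 1 ∧ Function.support k ⊆ Metric.ball 0 δ ∧
      ∀ x ∈ Ω, ∀ y ∈ tsupport χ, x - y ∈ tsupport k → y ∈ Ω) {ε : ℝ≥0∞} (hε : 0 < ε) :
    ∃ w : E → F, ContDiff ℝ ∞ w ∧
      eLpNorm (fun x => w x - χ x • u x) 2 (volume.restrict Ω) ≤ ε ∧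
      eLpNorm (fun x => A (fderiv ℝ w x) - (χ x • g x + A ((fderiv ℝ χ x).smulRight (u x)))) 2
        (volume.restrict Ω) ≤ ε := by
  have hdχ : Continuous (fderiv ℝ χ) := hχ.continuous_fderiv (by simp)
  have h1' := memLp_two_smul hχ.continuous hχc hu
  have h1 := (memLp_indicator_iff_restrict hΩ).2 h1'
  have h2' : MemLp (fun y => χ y • g y + A ((fderiv ℝ χ y).smulRight (u y))) 2
      (volume.restrict Ω) := (memLp_two_smul hχ.continuous hχc hg).add
    (memLp_two_smulRight (A := A) hdχ (hχc.fderiv ℝ) hu)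
  have h2 := (memLp_indicator_iff_restrict hΩ).2 h2'
  -- A single kernel has to approximate both the cut-off function and its image under the operator,
  -- hence the minimum of the two radii below.
  obtain ⟨δ₁, hδ₁, H₁⟩ := h1.exists_eLpNorm_translate_sub_le hε
  obtain ⟨δ₂, hδ₂, H₂⟩ := h2.exists_eLpNorm_translate_sub_le hε
  obtain ⟨k, hk, hkc, hk0, hk1, hks, hgeom⟩ := hker (min δ₁ δ₂) (lt_min hδ₁ hδ₂)
  -- Extending by zero may destroy weak differentiability across the boundary. This is harmless: the
  -- operator is commuted with the convolution only at points of `Ω`, and only these enter the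
  -- norms.
  refine ⟨k ⋆[ContinuousLinearMap.lsmul ℝ ℝ, volume] Ω.indicator fun y => χ y • u y,
    hkc.contDiff_convolution_left (n := ⊤) _ hk (h1.locallyIntegrable (by norm_num)), ?_, ?_⟩
  · have := eLpNorm_convolution_sub_le hk.continuous hk0 hkc hk1 h1
      (fun z hz => H₁ z (by simpa using (mem_ball_zero_iff.1 (hks hz)).trans_le (min_le_left _ _)))
    refine (eLpNorm_congr_ae ?_).trans_le ((eLpNorm_mono_measure _ Measure.restrict_le_self).trans this)
    filter_upwards [ae_restrict_mem hΩ] with x hx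
    rw [indicator_of_mem hx]
  · have := eLpNorm_convolution_sub_le hk.continuous hk0 hkc hk1 h2
      (fun z hz => H₂ z (by simpa using (mem_ball_zero_iff.1 (hks hz)).trans_le (min_le_right _ _)))
    refine (eLpNorm_congr_ae ?_).trans_le ((eLpNorm_mono_measure _ Measure.restrict_le_self).trans this)
    filter_upwards [ae_restrict_mem hΩ] with x hx
    rw [indicator_of_mem hx,
      hw.apply_fderiv_convolution hΩ hu hg hχ hχc hk hkc hgeom hx]

end WeakOperator

/-! ### Rotated coordinates of a chart -/

namespace LipschitzChart

variable {d : ℕ} (c : LipschitzChart d)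

/-- The upward unit vector of the rotated coordinate system. -/
noncomputable def up : Euc (d + 1) := c.point 0 1

lemma point_add (y y' : Euc d) (t t' : ℝ) :
    c.point (y + y') (t + t') = c.point y t + c.point y' t' := by
  unfold point
  rw [← map_add]
  congr 1
  ext i
  refine Fin.lastCases ?_ (fun j => ?_) i <;> simp

lemma point_smul (a : ℝ) (y : Euc d) (t : ℝ) : c.point (a • y) (a * t) = a • c.point y t := by
  unfold point
  rw [← map_smul]
  congr 1
  ext i
  refine Fin.lastCases ?_ (fun j => ?_) i <;> simp

lemma height_point (y : Euc d) (t : ℝ) : c.height (c.point y t) = t := by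
  simp [height, point]

lemma point_base_height (x : Euc (d + 1)) : c.point (c.base x) (c.height x) = x := by
  unfold point base height
  rw [LinearIsometryEquiv.symm_apply_eq]
  ext i
  refine Fin.lastCases ?_ (fun j => ?_) i <;> simp

lemma base_add (x y : Euc (d + 1)) : c.base (x + y) = c.base x + c.base y := by
  ext i; simp [base]

lemma height_add (x y : Euc (d + 1)) : c.height (x + y) = c.height x + c.height y := by
  simp [height]

lemma continuous_height : Continuous c.height := by
  unfold height
  have := c.rot.continuous
  fun_prop

lemma norm_base_le (x : Euc (d + 1)) : ‖c.base x‖ ≤ ‖x‖ := by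
  have h := c.norm_point_sq (c.base x) (c.height x)
  rw [point_base_height] at h
  exact le_of_sq_le_sq (by nlinarith [sq_nonneg (c.height x)]) (norm_nonneg _)

lemma abs_height_le (x : Euc (d + 1)) : |c.height x| ≤ ‖x‖ := by
  have h := c.norm_point_sq (c.base x) (c.height x)
  rw [point_base_height] at h
  exact le_of_sq_le_sq (by rw [sq_abs]; nlinarith [sq_nonneg ‖c.base x‖]) (norm_nonneg _)

lemma norm_up : ‖c.up‖ = 1 := by
  have h := c.norm_point_sq 0 1
  have h2 : ‖c.up‖ ^ 2 = 1 := h.trans (by simp)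
  exact (pow_eq_one_iff_of_nonneg (norm_nonneg _) two_ne_zero).1 h2

lemma base_smul_up (t : ℝ) : c.base (t • c.up) = 0 := by
  rw [up, ← point_smul, base_point, smul_zero]

lemma height_smul_up (t : ℝ) : c.height (t • c.up) = t := by
  rw [up, ← point_smul, height_point, mul_one]

end LipschitzChart

/-- Normalised bumps. -/
lemma exists_contDiff_kernel {n : ℕ} (a : Euc n) {ρ : ℝ} (hρ : 0 < ρ) :
    ∃ k : Euc n → ℝ, ContDiff ℝ ∞ k ∧ HasCompactSupport k ∧ (∀ x, 0 ≤ k x) ∧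
      ∫ x, k x = 1 ∧ tsupport k = Metric.closedBall a ρ := by
  let b : ContDiffBump a := ⟨ρ / 2, ρ, by positivity, by linarith⟩
  exact ⟨b.normed volume, b.contDiff_normed (n := ⊤), b.hasCompactSupport_normed,
    b.nonneg_normed, b.integral_normed, b.tsupport_normed_eq⟩

/-! ### Smooth approximation up to the boundary -/

namespace LipschitzDomain

variable {d : ℕ} (D : LipschitzDomain d)

lemma exists_kernel_interior {χ : Euc (d + 1) → ℝ} (hχ : tsupport χ ⊆ D.carrier) (δ : ℝ)
    (hδ : 0 < δ) : ∃ k : Euc (d + 1) → ℝ, ContDiff ℝ ∞ k ∧ HasCompactSupport k ∧ (∀ x, 0 ≤ k x) ∧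
      ∫ x, k x = 1 ∧ Function.support k ⊆ Metric.ball 0 δ ∧
      ∀ x ∈ D.carrier, ∀ y ∈ tsupport χ, x - y ∈ tsupport k → y ∈ D.carrier := by
  obtain ⟨k, h1, h2, h3, h4, h5⟩ := exists_contDiff_kernel (0 : Euc (d + 1)) (half_pos hδ)
  refine ⟨k, h1, h2, h3, h4, ?_, fun x _ y hy _ => hχ hy⟩
  refine (subset_tsupport k).trans (h5.trans_subset ?_)
  exact Metric.closedBall_subset_ball (by linarith)

/-- The kernel is a bump around `t • up`: the convolution at `x` samples points `y = x - z` with `z`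
close to `t • up`, that is, points below `x`. The Lipschitz bound on `φ` keeps them below the graph
if the bump is narrow compared with `t`. -/
lemma exists_kernel_chart (i : Fin D.N) {χ : Euc (d + 1) → ℝ} (hc : HasCompactSupport χ)
    (hχ : tsupport χ ⊆ (D.chart i).nbhd) (δ : ℝ) (hδ : 0 < δ) :
    ∃ k : Euc (d + 1) → ℝ, ContDiff ℝ ∞ k ∧ HasCompactSupport k ∧ (∀ x, 0 ≤ k x) ∧
      ∫ x, k x = 1 ∧ Function.support k ⊆ Metric.ball 0 δ ∧
      ∀ x ∈ D.carrier, ∀ y ∈ tsupport χ, x - y ∈ tsupport k → y ∈ D.carrier := by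
  obtain ⟨r, hr, hrs⟩ := hc.isCompact.exists_thickening_subset_open (D.chart i).isOpen_nbhd hχ
  set c := D.chart i with hci
  obtain ⟨K, hK⟩ := c.lipschitz
  -- The kernel's support lies within `2 * t` of the origin. This is to be less than `δ`, as
  -- required, and less than `r`, so that `x` stays in the chart whenever `y` is in the support of
  -- `χ`.
  obtain ⟨t, ht, htδ, htr⟩ : ∃ t > 0, 2 * t < δ ∧ 2 * t < r :=
    ⟨min δ r / 4, by positivity, by linarith [min_le_left δ r], by linarith [min_le_right δ r]⟩
  -- Deviating by `ρ` from the vertical shift costs at most `ρ` in height and `K * ρ` in `φ`.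
  -- Together they may not exceed the descent `t`.
  obtain ⟨ρ, hρ, hρt, hρK⟩ : ∃ ρ > 0, ρ ≤ t ∧ ρ * (1 + K) ≤ t := by
    have hpos : (0 : ℝ) < 1 + K := by positivity
    refine ⟨t / (1 + K), by positivity, div_le_self ht.le (by simp), ?_⟩
    rw [div_mul_cancel₀ _ hpos.ne']
  obtain ⟨k, h1, h2, h3, h4, h5⟩ := exists_contDiff_kernel (t • c.up) hρ
  have hnorm : ∀ z ∈ tsupport k, ‖z‖ ≤ 2 * t := fun z hz => by
    rw [h5, mem_closedBall_iff_norm] at hz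
    calc ‖z‖ = ‖(z - t • c.up) + t • c.up‖ := by simp
      _ ≤ ‖z - t • c.up‖ + ‖t • c.up‖ := norm_add_le _ _
      _ ≤ ρ + t := by
        rw [norm_smul, c.norm_up, mul_one, Real.norm_of_nonneg ht.le]; gcongr
      _ ≤ 2 * t := by linarith
  refine ⟨k, h1, h2, h3, h4, ?_, fun x hx y hy hxy => ?_⟩
  · intro z hz
    rw [mem_ball_zero_iff]
    exact (hnorm z (subset_tsupport k hz)).trans_lt htδ
  · have hxn : x ∈ c.nbhd := hrs (Metric.mem_thickening_iff.2 ⟨y, hy, by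
      rw [dist_eq_norm]; exact (hnorm _ hxy).trans_lt htr⟩)
    have hxc := (D.mem_iff i x hxn).1 hx
    rw [h5, mem_closedBall_iff_norm] at hxy
    obtain ⟨z, hz⟩ : ∃ z, z = x - y - t • c.up := ⟨_, rfl⟩
    rw [← hz] at hxy
    have hxe : x = y + (t • c.up + z) := by rw [hz]; abel
    have hb : c.base x = c.base y + c.base z := by
      rw [hxe, c.base_add, c.base_add, c.base_smul_up, zero_add]
    have hh : c.height x = c.height y + (t + c.height z) := by
      rw [hxe, c.height_add, c.height_add, c.height_smul_up]
    refine (D.mem_iff i y (hχ hy)).2 ?_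
    have hl : c.φ (c.base x) ≤ c.φ (c.base y) + K * ρ := by
      have h6 := hK.dist_le_mul (c.base x) (c.base y)
      rw [hb, dist_eq_norm, dist_eq_norm, add_sub_cancel_left, ← hb] at h6
      have h7 := (le_abs_self _).trans h6
      have h8 : (K : ℝ) * ‖c.base z‖ ≤ K * ρ := by
        gcongr; exact (c.norm_base_le z).trans hxy
      linarith
    have h9 := (neg_le_of_abs_le ((c.abs_height_le z).trans hxy))
    rw [← hci] at hxc
    -- `height y = height x - t - height z < φ (base x) - t + ρ ≤ φ (base y) + K * ρ + ρ - t ≤ φ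
    -- (base y)`.
    nlinarith

/-- A smooth partition of unity subordinate to the domain and its charts. -/
lemma exists_partition : ∃ χ : Option (Fin D.N) → Euc (d + 1) → ℝ,
    (∀ j, ContDiff ℝ ∞ (χ j)) ∧ (∀ j, HasCompactSupport (χ j)) ∧ (∀ j x, 0 ≤ χ j x) ∧
    tsupport (χ none) ⊆ D.carrier ∧ (∀ i, tsupport (χ (some i)) ⊆ (D.chart i).nbhd) ∧
    ∀ x ∈ closure D.carrier, ∑ j, χ j x = 1 := by
  obtain ⟨f, hf⟩ := SmoothPartitionOfUnity.exists_isSubordinate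
    (modelWithCornersSelf ℝ (Euc (d + 1))) (isClosed_closure (s := D.carrier))
    (fun j : Option (Fin D.N) => j.elim D.carrier fun i => (D.chart i).nbhd)
    (by rintro (_ | i); exacts [D.isOpen, (D.chart i).isOpen_nbhd])
    (by
      intro x hx
      by_cases h : x ∈ D.carrier
      · exact mem_iUnion.2 ⟨none, h⟩
      · have hfr : x ∈ frontier D.carrier := ⟨hx, by rwa [D.isOpen.interior_eq]⟩
        obtain ⟨i, hi⟩ := mem_iUnion.1 (D.frontier_subset hfr)
        exact mem_iUnion.2 ⟨some i, hi⟩)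
  have hb : ∀ j : Option (Fin D.N),
      Bornology.IsBounded (j.elim D.carrier fun i => (D.chart i).nbhd) := by
    rintro (_ | i)
    exacts [D.isBounded, (D.chart i).isBounded_nbhd]
  refine ⟨fun j => f j, fun j => (f j).contMDiff.contDiff, fun j => ?_, fun j x => f.nonneg j x,
    hf none, fun i => hf (some i), fun x hx => ?_⟩
  · exact Metric.isCompact_of_isClosed_isBounded (isClosed_tsupport _) ((hb j).subset (hf j))
  · rw [← finsum_eq_sum_of_fintype]
    exact f.sum_eq_one hx

/-- This makes the commutator terms `A (Dχⱼ ⊗ u)` cancel when the local approximations are added. -/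
lemma sum_fderiv_partition {χ : Option (Fin D.N) → Euc (d + 1) → ℝ}
    (hχ : ∀ j, ContDiff ℝ ∞ (χ j)) (h1 : ∀ x ∈ closure D.carrier, ∑ j, χ j x = 1)
    {x : Euc (d + 1)} (hx : x ∈ D.carrier) : ∑ j, fderiv ℝ (χ j) x = 0 := by
  rw [← fderiv_fun_sum fun j _ => (hχ j).differentiable (by simp) x]
  have : (fun y => ∑ j, χ j y) =ᶠ[nhds x] fun _ => (1 : ℝ) := by
    filter_upwards [D.isOpen.mem_nhds hx] with y hy using h1 y (subset_closure hy)
  rw [this.fderiv_eq]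
  simp

lemma eLpNorm_sum_le_card_mul {ι α H : Type*} [Fintype ι] [MeasurableSpace α] {μ : Measure α}
    [NormedAddCommGroup H] {f : ι → α → H} {η : ℝ≥0∞} (hf : ∀ j, AEStronglyMeasurable (f j) μ)
    (hf' : ∀ j, eLpNorm (f j) 2 μ ≤ η) :
    eLpNorm (∑ j, f j) 2 μ ≤ (Finset.univ : Finset ι).card * η := by
  refine (eLpNorm_sum_le (fun j _ => hf j) (by norm_num)).trans ?_
  refine (Finset.sum_le_card_nsmul _ _ η fun j _ => hf' j).trans ?_
  rw [nsmul_eq_mul]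

/-- Meyers-Serrin up to the boundary: functions smooth on the whole space are dense for the graph
norm of a first order operator with constant coefficients. -/
lemma exists_contDiff_approx {F G : Type*} [NormedAddCommGroup F] [NormedSpace ℝ F]
    [CompleteSpace F] [NormedAddCommGroup G] [NormedSpace ℝ G] [CompleteSpace G]
    {A : (Euc (d + 1) →L[ℝ] F) →L[ℝ] G} {u : Euc (d + 1) → F} {g : Euc (d + 1) → G}
    (hw : HasWeakImage A D.carrier u g)
    (hu : MemLp u 2 (volume.restrict D.carrier)) (hg : MemLp g 2 (volume.restrict D.carrier))
    {ε : ℝ≥0∞} (hε : ε ≠ 0) : ∃ w : Euc (d + 1) → F, ContDiff ℝ ∞ w ∧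
      eLpNorm (fun x => w x - u x) 2 (volume.restrict D.carrier) ≤ ε ∧
      eLpNorm (fun x => A (fderiv ℝ w x) - g x) 2 (volume.restrict D.carrier) ≤ ε := by
  obtain ⟨χ, hχ, hχc, -, hχ0, hχi, hχ1⟩ := D.exists_partition
  -- The error is shared equally among the members of the partition.
  obtain ⟨η, hη, hηε⟩ : ∃ η : ℝ≥0∞, 0 < η ∧ (Finset.univ : Finset (Option (Fin D.N))).card * η ≤ ε := by
    refine ⟨ε / (Finset.univ : Finset (Option (Fin D.N))).card, ?_, ENNReal.mul_div_le⟩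
    exact ENNReal.div_pos hε (ENNReal.natCast_ne_top _)
  have key : ∀ j, ∃ w : Euc (d + 1) → F, ContDiff ℝ ∞ w ∧
      eLpNorm (fun x => w x - χ j x • u x) 2 (volume.restrict D.carrier) ≤ η ∧
      eLpNorm (fun x => A (fderiv ℝ w x) -
        (χ j x • g x + A ((fderiv ℝ (χ j) x).smulRight (u x)))) 2
        (volume.restrict D.carrier) ≤ η := by
    intro j
    refine hw.exists_contDiff_approx D.isOpen.measurableSet hu hg (hχ j) (hχc j) ?_ hη
    cases j with
    | none => exact D.exists_kernel_interior hχ0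
    | some i => exact D.exists_kernel_chart i (hχc _) (hχi i)
  choose w hw1 hw2 hw3 using key
  refine ⟨fun x => ∑ j, w j x, ContDiff.sum fun j _ => hw1 j, ?_, ?_⟩
  · refine (eLpNorm_congr_ae ?_).trans_le ((eLpNorm_sum_le_card_mul (f := fun j x => w j x - χ j x • u x)
      (fun j => ?_) hw2).trans hηε)
    · filter_upwards [ae_restrict_mem D.isOpen.measurableSet] with x hx
      rw [Finset.sum_apply, Finset.sum_sub_distrib, ← Finset.sum_smul, hχ1 x (subset_closure hx), one_smul]
    · exact (hw1 j).continuous.aestronglyMeasurable.sub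
        ((hχ j).continuous.aestronglyMeasurable.smul hu.1)
  · refine (eLpNorm_congr_ae ?_).trans_le ((eLpNorm_sum_le_card_mul (f := fun j x => A (fderiv ℝ (w j) x) -
        (χ j x • g x + A ((fderiv ℝ (χ j) x).smulRight (u x)))) (fun j => ?_) hw3).trans hηε)
    · filter_upwards [ae_restrict_mem D.isOpen.measurableSet] with x hx
      have h0 : ∑ j, A ((fderiv ℝ (χ j) x).smulRight (u x)) = 0 := by
        rw [← map_sum]
        have : ∑ j, (fderiv ℝ (χ j) x).smulRight (u x)
            = (∑ j, fderiv ℝ (χ j) x).smulRight (u x) := by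
          ext v; simp [Finset.sum_smul, add_smul]
        rw [this, D.sum_fderiv_partition hχ hχ1 hx]
        have : (0 : Euc (d + 1) →L[ℝ] ℝ).smulRight (u x) = 0 := by ext v; simp
        rw [this, map_zero]
      rw [Finset.sum_apply, Finset.sum_sub_distrib, Finset.sum_add_distrib, ← Finset.sum_smul,
        hχ1 x (subset_closure hx), one_smul, h0, add_zero,
        fderiv_fun_sum fun j _ => (hw1 j).differentiable (by simp) x, map_sum]
    · refine (A.continuous.comp ((hw1 j).continuous_fderiv (by simp))).aestronglyMeasurable.sub ?_
      exact ((hχ j).continuous.aestronglyMeasurable.smul hg.1).add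
        (memLp_two_smulRight ((hχ j).continuous_fderiv (by simp)) ((hχc j).fderiv ℝ) hu).1

/-! ### Density of the smooth functions -/

/-- The gradient as a linear function of the derivative. -/
noncomputable def gradientSymbol (n : ℕ) : (Euc n →L[ℝ] ℝ) →L[ℝ] Euc n :=
  LinearMap.toContinuousLinearMap
    { toFun := fun ξ => (InnerProductSpace.toDual ℝ (Euc n)).symm ξ
      map_add' := fun ξ η => map_add _ ξ η
      map_smul' := fun a ξ => by simp }

lemma gradientSymbol_apply (n : ℕ) (ξ : Euc n →L[ℝ] ℝ) :
    gradientSymbol n ξ = (InnerProductSpace.toDual ℝ (Euc n)).symm ξ := rfl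

/-- The divergence as a linear function of the derivative. -/
noncomputable def divergenceSymbol (n : ℕ) : (Euc n →L[ℝ] Euc n) →L[ℝ] ℝ :=
  LinearMap.toContinuousLinearMap
    { toFun := fun T => ∑ i, T (EuclideanSpace.single i 1) i
      map_add' := fun S T => by simp [Finset.sum_add_distrib]
      map_smul' := fun a T => by simp [Finset.mul_sum] }

lemma divergenceSymbol_apply (n : ℕ) (T : Euc n →L[ℝ] Euc n) :
    divergenceSymbol n T = ∑ i, T (EuclideanSpace.single i 1) i := rfl

lemma divergenceSymbol_smulRight (n : ℕ) (ξ : Euc n →L[ℝ] ℝ) (v : Euc n) :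
    divergenceSymbol n (ξ.smulRight v) = ξ v := by
  conv_rhs => rw [← (EuclideanSpace.basisFun (Fin n) ℝ).sum_repr v]
  simp [divergenceSymbol_apply, mul_comm]

/-- Taking inner products with each direction `e` turns the vector equation into the scalar
equations of `HasWeakGradient`. -/
lemma hasWeakImage_gradientSymbol {p : WithLp 2 (D.L2 × D.L2Vec)} (hp : p ∈ D.H1Submodule) :
    HasWeakImage (gradientSymbol (d + 1)) D.carrier p.fst p.snd := by
  intro ψ h1 h2 h3
  have hi1 : Integrable (fun x => gradientSymbol (d + 1) ((fderiv ℝ ψ x).smulRight (p.fst x)))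
      (volume.restrict D.carrier) :=
    (memLp_two_smulRight (h1.continuous_fderiv (by simp)) (h2.fderiv ℝ)
      (Lp.memLp p.fst)).integrable (by norm_num)
  have hi2 : Integrable (fun x => ψ x • p.snd x) (volume.restrict D.carrier) :=
    (memLp_two_smul h1.continuous h2 (Lp.memLp p.snd)).integrable (by norm_num)
  refine ext_inner_left ℝ fun e => ?_
  rw [inner_neg_right, ← integral_inner hi1, ← integral_inner hi2]
  have := hp ψ ⟨h1, h2, h3⟩ e
  refine Eq.trans (integral_congr_ae (Filter.Eventually.of_forall fun x => ?_))
    (this.trans (congrArg Neg.neg (integral_congr_ae (Filter.Eventually.of_forall fun x => ?_))))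
  · simp only
    rw [gradientSymbol_apply, real_inner_comm, InnerProductSpace.toDual_symm_apply]
    simp [mul_comm]
  · simp only
    rw [inner_smul_right, real_inner_comm, mul_comm]

lemma hasWeakImage_divergenceSymbol {p : WithLp 2 (D.L2Vec × D.L2)} (hp : p ∈ D.HdivSubmodule) :
    HasWeakImage (divergenceSymbol (d + 1)) D.carrier p.fst p.snd := by
  intro ψ h1 h2 h3
  simp only [divergenceSymbol_smulRight, smul_eq_mul]
  refine (hp ψ ⟨h1, h2, h3⟩).trans ?_
  simp only [mul_comm]

lemma norm_sub_toLp_le {α F : Type*} [MeasurableSpace α] {μ : Measure α} [NormedAddCommGroup F]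
    (u : Lp F 2 μ) {w : α → F} (hw : MemLp w 2 μ) {ε : ℝ} (hε : 0 ≤ ε)
    (h : eLpNorm (fun x => w x - u x) 2 μ ≤ ENNReal.ofReal ε) : ‖u - hw.toLp w‖ ≤ ε := by
  rw [norm_sub_rev, Lp.norm_def]
  refine ENNReal.toReal_le_of_le_ofReal hε ((eLpNorm_congr_ae ?_).trans_le h)
  filter_upwards [Lp.coeFn_sub (hw.toLp w) u, hw.coeFn_toLp] with x h1 h2
  rw [h1, Pi.sub_apply, h2]

lemma norm_withLp_prod_le {X Y : Type*} [NormedAddCommGroup X] [NormedAddCommGroup Y]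
    (p : WithLp 2 (X × Y)) : ‖p‖ ≤ ‖p.fst‖ + ‖p.snd‖ := by
  have h := WithLp.prod_norm_sq_eq_of_L2 p
  refine le_of_sq_le_sq ?_ (by positivity)
  nlinarith [norm_nonneg p.fst, norm_nonneg p.snd]

lemma denseRange_smoothToH1 : DenseRange D.smoothToH1 := by
  refine Metric.denseRange_iff.2 fun p r hr => ?_
  obtain ⟨p, hp⟩ := p
  -- The graph norm is at most the sum of its two components, hence at most `2 * r / 3 < r`.
  obtain ⟨w, hw1, hw2, hw3⟩ := D.exists_contDiff_approx (D.hasWeakImage_gradientSymbol hp)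
    (Lp.memLp _) (Lp.memLp _) (ε := ENNReal.ofReal (r / 3)) (by simpa using hr)
  refine ⟨⟨w, hw1⟩, ?_⟩
  have h1 := norm_sub_toLp_le p.fst (D.memLp_carrier hw1.continuous) (by positivity) hw2
  have h2 := norm_sub_toLp_le p.snd (D.memLp_carrier (continuous_gradient hw1))
    (by positivity) hw3
  have h3 := norm_withLp_prod_le (p - (D.smoothToH1Submodule ⟨w, hw1⟩).1)
  have h4 : dist (⟨p, hp⟩ : D.H1Submodule) (D.smoothToH1Submodule ⟨w, hw1⟩)
      = ‖p - (D.smoothToH1Submodule ⟨w, hw1⟩).1‖ := by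
    rw [Subtype.dist_eq, dist_eq_norm]
  refine h4.trans_lt (h3.trans_lt ((add_le_add h1 h2).trans_lt ?_))
  linarith

lemma denseRange_smoothToHdiv : DenseRange D.smoothToHdiv := by
  refine Metric.denseRange_iff.2 fun p r hr => ?_
  obtain ⟨p, hp⟩ := p
  obtain ⟨w, hw1, hw2, hw3⟩ := D.exists_contDiff_approx (D.hasWeakImage_divergenceSymbol hp)
    (Lp.memLp _) (Lp.memLp _) (ε := ENNReal.ofReal (r / 3)) (by simpa using hr)
  refine ⟨⟨w, hw1⟩, ?_⟩
  have h1 := norm_sub_toLp_le p.fst (D.memLp_carrier hw1.continuous) (by positivity) hw2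
  have h2 := norm_sub_toLp_le p.snd (D.memLp_carrier (continuous_divergence hw1))
    (by positivity) hw3
  have h3 := norm_withLp_prod_le (p - (D.smoothToHdivSubmodule ⟨w, hw1⟩).1)
  have h4 : dist (⟨p, hp⟩ : D.HdivSubmodule) (D.smoothToHdivSubmodule ⟨w, hw1⟩)
      = ‖p - (D.smoothToHdivSubmodule ⟨w, hw1⟩).1‖ := by
    rw [Subtype.dist_eq, dist_eq_norm]
  refine h4.trans_lt (h3.trans_lt ((add_le_add h1 h2).trans_lt ?_))
  linarith

end LipschitzDomain

/-! ### Gauss-Green formula below a Lipschitz graph -/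

namespace LipschitzChart

variable {d : ℕ} (c : LipschitzChart d)

/-- `point` as a linear map. -/
noncomputable def pointCLM : Euc d × ℝ →L[ℝ] Euc (d + 1) :=
  LinearMap.toContinuousLinearMap
    { toFun := fun p => c.point p.1 p.2
      map_add' := fun _ _ => c.point_add _ _ _ _
      map_smul' := fun _ _ => c.point_smul _ _ _ }

lemma pointCLM_apply (p : Euc d × ℝ) : c.pointCLM p = c.point p.1 p.2 := rfl

lemma inner_point (y y' : Euc d) (t t' : ℝ) :
    ⟪c.point y t, c.point y' t'⟫_ℝ = ⟪y, y'⟫_ℝ + t * t' := by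
  unfold point
  rw [LinearIsometryEquiv.inner_map_map]
  simp [PiLp.inner_apply, Fin.sum_univ_castSucc, mul_comm]

lemma measurePreserving_point :
    MeasurePreserving (fun p : Euc d × ℝ => c.point p.1 p.2) volume volume := by
  -- `piFinSuccAbove` splits off the distinguished coordinate as the first factor, hence the swap.
  have h1 : MeasurePreserving (Prod.map id (WithLp.ofLp : Euc d → Fin d → ℝ) ∘ Prod.swap :
      Euc d × ℝ → ℝ × (Fin d → ℝ)) volume volume :=
    ((MeasurePreserving.id volume).prod (PiLp.volume_preserving_ofLp (Fin d))).comp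
      Measure.measurePreserving_swap
  have h2 := (volume_preserving_piFinSuccAbove (fun _ : Fin (d + 1) => ℝ) (Fin.last d)).symm
  have h3 := PiLp.volume_preserving_toLp (Fin (d + 1))
  have h4 := (c.rot.symm.measurePreserving).comp (h3.comp (h2.comp h1))
  convert! h4 using 1
  funext p
  simp only [Function.comp, point]
  congr 2
  exact (Fin.insertNth_last' p.2 (fun i => p.1 i)).symm

/-- The coordinates in which the graph of `φ` is flat: `(y, s) ↦ point y (φ y + s)`. -/
noncomputable def flatten : Euc d × ℝ ≃ₜ Euc (d + 1) where
  toFun p := c.point p.1 (c.φ p.1 + p.2)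
  invFun x := (c.base x, c.height x - c.φ (c.base x))
  left_inv p := by simp [base_point, height_point]
  right_inv x := by simp [point_base_height]
  continuous_toFun := by
    have := c.continuous_φ
    exact c.continuous_point.comp (by fun_prop : Continuous fun p : Euc d × ℝ => (p.1, c.φ p.1 + p.2))
  continuous_invFun := by
    have h1 := c.continuous_φ
    have h2 := c.continuous_base
    have h3 := c.continuous_height
    fun_prop

lemma flatten_apply (p : Euc d × ℝ) : c.flatten p = c.point p.1 (c.φ p.1 + p.2) := rfl

/-- A shear translates each vertical fibre, so Fubini gives invariance of the volume; no derivative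
of `φ` and no Jacobian are involved. -/
lemma measurePreserving_flatten : MeasurePreserving c.flatten volume volume := by
  have h := (MeasurePreserving.id (volume : Measure (Euc d))).skew_product
    (g := fun y s => c.φ y + s) (μc := (volume : Measure ℝ)) (μd := volume)
    (by
      have := c.continuous_φ
      exact Continuous.measurable (by unfold Function.uncurry; fun_prop))
    (Filter.Eventually.of_forall fun y => (measurePreserving_add_left volume (c.φ y)).map_eq)
  exact c.measurePreserving_point.comp h

/-- The region below the graph of `φ`. -/
def subgraph : Set (Euc (d + 1)) := {x | c.height x < c.φ (c.base x)}

lemma measurableSet_subgraph : MeasurableSet c.subgraph :=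
  (isOpen_lt c.continuous_height (c.continuous_φ.comp c.continuous_base)).measurableSet

lemma restrict_flatten :
    (volume : Measure (Euc d × ℝ)).restrict (c.flatten ⁻¹' c.subgraph)
      = (volume : Measure (Euc d)).prod ((volume : Measure ℝ).restrict (Iio 0)) := by
  have : c.flatten ⁻¹' c.subgraph = univ ×ˢ Iio 0 := by
    ext p
    simp [subgraph, flatten_apply, height_point, base_point]
  rw [this, Measure.volume_eq_prod, ← Measure.prod_restrict, Measure.restrict_univ]

lemma setIntegral_subgraph (g : Euc (d + 1) → ℝ) :
    ∫ x in c.subgraph, g x = ∫ p, g (c.flatten p)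
      ∂((volume : Measure (Euc d)).prod ((volume : Measure ℝ).restrict (Iio 0))) := by
  rw [← c.restrict_flatten, c.measurePreserving_flatten.setIntegral_preimage_emb
    c.flatten.measurableEmbedding]

lemma integrable_flatten {g : Euc (d + 1) → ℝ} (hg : Continuous g) (hc : HasCompactSupport g) :
    Integrable (fun p => g (c.flatten p))
      ((volume : Measure (Euc d)).prod ((volume : Measure ℝ).restrict (Iio 0))) := by
  rw [← c.restrict_flatten]
  exact ((hg.comp c.flatten.continuous).integrable_of_hasCompactSupport
    (hc.comp_homeomorph c.flatten)).restrict

/-- Fundamental theorem of calculus on a vertical half-line; the compact support removes the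
contribution at `-∞`. -/
lemma integral_Iio_fderiv_up {f : Euc (d + 1) → ℝ} (hf : ContDiff ℝ 1 f)
    (hc : HasCompactSupport f) (y : Euc d) :
    ∫ s in Iio (0 : ℝ), fderiv ℝ f (c.flatten (y, s)) c.up = f (c.point y (c.φ y)) := by
  have hpt : ∀ s, c.flatten (y, s) = c.point y (c.φ y) + s • c.up := fun s => by
    rw [flatten_apply, up, ← point_smul, ← point_add]; simp
  have hcd : ContDiff ℝ 1 fun s : ℝ => f (c.flatten (y, s)) := by
    simp only [hpt]
    exact hf.comp (contDiff_const.add (contDiff_id.smul contDiff_const))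
  have hcs : HasCompactSupport fun s : ℝ => f (c.flatten (y, s)) :=
    (hc.comp_homeomorph c.flatten).comp_isClosedEmbedding
      (Topology.IsClosedEmbedding.of_continuous_injective_isClosedMap (by fun_prop)
        (Prod.mk_right_injective y) (isClosedMap_prodMk_left y))
  have h := hcs.integral_Iic_deriv_eq hcd 0
  rw [integral_Iic_eq_integral_Iio] at h
  rw [hpt, zero_smul, add_zero] at h
  rw [← h]
  refine integral_congr_ae (Filter.Eventually.of_forall fun s => ?_)
  have h1 : HasDerivAt (fun s : ℝ => c.flatten (y, s)) c.up s := by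
    simp only [hpt]
    simpa using ((hasDerivAt_id s).smul_const c.up).const_add (c.point y (c.φ y))
  exact (((hf.differentiable one_ne_zero _).hasFDerivAt.comp_hasDerivAt s h1).deriv).symm

lemma norm_point_le (y : Euc d) (t : ℝ) : ‖c.point y t‖ ≤ ‖y‖ + |t| := by
  have h := c.norm_point_sq y t
  refine le_of_sq_le_sq ?_ (by positivity)
  rw [h, ← sq_abs t]
  nlinarith [norm_nonneg y, abs_nonneg t]

/-- By the chain rule, valid almost everywhere by Rademacher's theorem, the integrand is the
derivative in direction `b` of `y ↦ f (flatten (y, s))`. This function is Lipschitz with compact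
support, so its derivative has integral zero. -/
lemma integral_fderiv_horizontal {f : Euc (d + 1) → ℝ} (hf : ContDiff ℝ 1 f)
    (hc : HasCompactSupport f) (b : Euc d) (s : ℝ) :
    ∫ y, (fderiv ℝ f (c.flatten (y, s)) (c.point b 0)
      + fderiv ℝ c.φ y b * fderiv ℝ f (c.flatten (y, s)) c.up) = 0 := by
  obtain ⟨K, hK⟩ := c.lipschitz
  obtain ⟨C, hC⟩ := hf.lipschitzWith_of_hasCompactSupport hc one_ne_zero
  have hfl : LipschitzWith (1 + K) fun y : Euc d => c.flatten (y, s) := by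
    refine LipschitzWith.of_dist_le_mul fun y y' => ?_
    have e : c.flatten (y, s) - c.flatten (y', s) = c.point (y - y') (c.φ y - c.φ y') := by
      rw [sub_eq_iff_eq_add, flatten_apply, flatten_apply, ← point_add]
      congr 1
      · simp
      · ring
    rw [dist_eq_norm, e]
    refine (c.norm_point_le _ _).trans ?_
    have := hK.dist_le_mul y y'
    rw [dist_eq_norm, Real.norm_eq_abs] at this
    rw [dist_eq_norm] at this ⊢
    push_cast
    linarith
  have hH : LipschitzWith (C * (1 + K)) fun y : Euc d => f (c.flatten (y, s)) := hC.comp hfl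
  have hcs : HasCompactSupport fun y : Euc d => f (c.flatten (y, s)) :=
    (hc.comp_homeomorph c.flatten).comp_isClosedEmbedding
      (Topology.IsClosedEmbedding.of_continuous_injective_isClosedMap (by fun_prop)
        (Prod.mk_left_injective s) (isClosedMap_prodMk_right s))
  -- Integration by parts against the constant `1`. The rule reverses the direction, so `-b` here
  -- differentiates `f ∘ flatten` along `b`.
  have h0 := (LipschitzWith.const (1 : ℝ)).integral_lineDeriv_mul_eq (μ := volume)
    (C := 0) hH hcs (-b)
  simp only [neg_neg, mul_one] at h0
  have h1 : ∀ y : Euc d, lineDeriv ℝ (fun _ : Euc d => (1 : ℝ)) y (-b) = 0 := fun y => by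
    simp [lineDeriv]
  simp only [h1, zero_mul, integral_zero] at h0
  refine Eq.trans (integral_congr_ae ?_) h0.symm
  filter_upwards [hK.ae_differentiableAt] with y hy
  have h2 : HasFDerivAt (fun y : Euc d => c.flatten (y, s))
      (c.pointCLM.comp ((ContinuousLinearMap.id ℝ (Euc d)).prod (fderiv ℝ c.φ y))) y :=
    c.pointCLM.hasFDerivAt.comp y ((hasFDerivAt_id y).prodMk (hy.hasFDerivAt.add_const s))
  have h3 := (hf.differentiable one_ne_zero (c.flatten (y, s))).hasFDerivAt.comp y h2
  have h4 := h3.hasLineDerivAt b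
  refine Eq.trans ?_ h4.lineDeriv.symm
  have h5 : c.point b (fderiv ℝ c.φ y b) = c.point b 0 + fderiv ℝ c.φ y b • c.up := by
    rw [up, ← point_smul, ← point_add]; simp
  simp [pointCLM_apply, h5]

/-- The bound holds at every `y`, since `fderiv` is zero where `φ` is not differentiable. -/
lemma abs_fderiv_φ_le : ∃ M : ℝ, ∀ y b, ‖fderiv ℝ c.φ y b‖ ≤ M * ‖b‖ := by
  obtain ⟨K, hK⟩ := c.lipschitz
  exact ⟨K, fun y b => (ContinuousLinearMap.le_opNorm _ _).trans
    (mul_le_mul_of_nonneg_right (norm_fderiv_le_of_lipschitz ℝ hK) (norm_nonneg _))⟩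

/-- The Gauss-Green formula below the graph of a Lipschitz function, in a parametrisation of the
graph. -/
lemma setIntegral_subgraph_fderiv {f : Euc (d + 1) → ℝ} (hf : ContDiff ℝ 1 f)
    (hc : HasCompactSupport f) (e : Euc (d + 1)) :
    ∫ x in c.subgraph, fderiv ℝ f x e
      = ∫ y, f (c.point y (c.φ y)) * ⟪c.point (-gradient c.φ y) 1, e⟫_ℝ := by
  have hdf : Continuous (fderiv ℝ f) := hf.continuous_fderiv one_ne_zero
  have hi : ∀ v, Integrable (fun p => fderiv ℝ f (c.flatten p) v)
      ((volume : Measure (Euc d)).prod ((volume : Measure ℝ).restrict (Iio 0))) := fun v =>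
    c.integrable_flatten (hdf.clm_apply continuous_const) (hc.fderiv_apply ℝ v)
  obtain ⟨M, hM⟩ := c.abs_fderiv_φ_le
  have hm : Measurable fun p : Euc d × ℝ => fderiv ℝ c.φ p.1 (c.base e) :=
    (measurable_fderiv_apply_const ℝ c.φ (c.base e)).comp measurable_fst
  have hiφ : Integrable (fun p : Euc d × ℝ =>
      fderiv ℝ c.φ p.1 (c.base e) * fderiv ℝ f (c.flatten p) c.up)
      ((volume : Measure (Euc d)).prod ((volume : Measure ℝ).restrict (Iio 0))) :=
    (hi c.up).bdd_mul hm.aestronglyMeasurable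
      (Filter.Eventually.of_forall fun p => hM p.1 (c.base e))
  have hsum : Integrable (fun p : Euc d × ℝ => fderiv ℝ f (c.flatten p) (c.point (c.base e) 0)
      + fderiv ℝ c.φ p.1 (c.base e) * fderiv ℝ f (c.flatten p) c.up)
      ((volume : Measure (Euc d)).prod ((volume : Measure ℝ).restrict (Iio 0))) :=
    (hi _).add hiφ
  have hih := (hi c.up).const_mul (c.height e)
  have hsum' : Integrable (fun p : Euc d × ℝ => (fderiv ℝ f (c.flatten p) (c.point (c.base e) 0)
      + fderiv ℝ c.φ p.1 (c.base e) * fderiv ℝ f (c.flatten p) c.up)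
      + c.height e * fderiv ℝ f (c.flatten p) c.up)
      ((volume : Measure (Euc d)).prod ((volume : Measure ℝ).restrict (Iio 0))) :=
    hsum.add hih
  -- Vertical terms: the coefficient does not depend on `s`, so the inner integral over `s` is a
  -- boundary value.
  have hvert : ∀ a : Euc d → ℝ, Integrable (fun p : Euc d × ℝ =>
      a p.1 * fderiv ℝ f (c.flatten p) c.up)
      ((volume : Measure (Euc d)).prod ((volume : Measure ℝ).restrict (Iio 0))) →
      ∫ p, a p.1 * fderiv ℝ f (c.flatten p) c.up
        ∂((volume : Measure (Euc d)).prod ((volume : Measure ℝ).restrict (Iio 0)))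
        = ∫ y, a y * f (c.point y (c.φ y)) := fun a ha => by
    rw [integral_prod _ ha]
    refine integral_congr_ae (Filter.Eventually.of_forall fun y => ?_)
    simp only
    rw [integral_const_mul, c.integral_Iio_fderiv_up hf hc]
  -- Horizontal term: Fubini in the other order, since the cancellation takes place in the integral
  -- over `y`.
  have hhor : ∫ p, (fderiv ℝ f (c.flatten p) (c.point (c.base e) 0)
      + fderiv ℝ c.φ p.1 (c.base e) * fderiv ℝ f (c.flatten p) c.up)
      ∂((volume : Measure (Euc d)).prod ((volume : Measure ℝ).restrict (Iio 0))) = 0 := by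
    rw [integral_prod_symm _ hsum]
    simp [c.integral_fderiv_horizontal hf hc]
  have he : ∀ x, fderiv ℝ f x e = fderiv ℝ f x (c.point (c.base e) 0)
      + c.height e * fderiv ℝ f x c.up := fun x => by
    conv_lhs => rw [← c.point_base_height e]
    have : c.point (c.base e) (c.height e) = c.point (c.base e) 0 + c.height e • c.up := by
      rw [up, ← point_smul, ← point_add]; simp
    rw [this]; simp
  rw [c.setIntegral_subgraph]
  -- The term `∂φ · ∂_up f` is added and subtracted: it completes the horizontal derivative to a
  -- total derivative along the graph, and what remains supplies the component `-∇φ` of the normal.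
  have e1 : ∀ p : Euc d × ℝ, fderiv ℝ f (c.flatten p) e
      = ((fderiv ℝ f (c.flatten p) (c.point (c.base e) 0)
        + fderiv ℝ c.φ p.1 (c.base e) * fderiv ℝ f (c.flatten p) c.up)
        + c.height e * fderiv ℝ f (c.flatten p) c.up)
        - fderiv ℝ c.φ p.1 (c.base e) * fderiv ℝ f (c.flatten p) c.up := fun p => by
    rw [he]; ring
  simp only [e1]
  rw [integral_sub hsum' hiφ, integral_add hsum hih, hhor,
    zero_add, hvert (fun _ => c.height e) hih, hvert (fun y => fderiv ℝ c.φ y (c.base e)) hiφ]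
  have hγ : Continuous fun y => c.point y (c.φ y) :=
    c.continuous_point.comp (continuous_id.prodMk c.continuous_φ)
  have hcs : HasCompactSupport fun y : Euc d => f (c.point y (c.φ y)) := by
    have := (hc.comp_homeomorph c.flatten).comp_isClosedEmbedding
      (Topology.IsClosedEmbedding.of_continuous_injective_isClosedMap
        (f := fun y : Euc d => (y, (0 : ℝ))) (by fun_prop)
        (Prod.mk_left_injective 0) (isClosedMap_prodMk_right 0))
    simpa [Function.comp_def, flatten_apply] using this
  have hfi : Integrable fun y => f (c.point y (c.φ y)) :=
    (hf.continuous.comp hγ).integrable_of_hasCompactSupport hcs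
  rw [← integral_sub (hfi.const_mul _) (hfi.bdd_mul
    (measurable_fderiv_apply_const ℝ c.φ (c.base e)).aestronglyMeasurable
      (Filter.Eventually.of_forall fun y => hM y (c.base e)))]
  refine integral_congr_ae (Filter.Eventually.of_forall fun y => ?_)
  have h6 : ⟪c.point (-gradient c.φ y) 1, e⟫_ℝ = -fderiv ℝ c.φ y (c.base e) + c.height e := by
    conv_lhs => rw [← c.point_base_height e]
    rw [inner_point, inner_neg_left, gradient, InnerProductSpace.toDual_symm_apply, one_mul]
  simp only [h6]
  ring

lemma areaDensity_pos (y : Euc d) : 0 < c.areaDensity y := by unfold areaDensity; positivity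

lemma measurable_graph : Measurable fun y : Euc d => c.point y (c.φ y) :=
  (c.continuous_point.comp (continuous_id.prodMk c.continuous_φ)).measurable

lemma integral_graphMeasure {g : Euc (d + 1) → ℝ} (hg : Measurable g)
    (h0 : ∀ x, x ∉ c.nbhd → g x = 0) :
    ∫ x, g x ∂c.graphMeasure = ∫ y, c.areaDensity y * g (c.point y (c.φ y)) := by
  rw [graphMeasure, setIntegral_eq_integral_of_forall_compl_eq_zero h0,
    integral_map c.measurable_graph.aemeasurable hg.aestronglyMeasurable,
    integral_withDensity_eq_integral_toReal_smul c.measurable_areaDensity.ennreal_ofReal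
      (Filter.Eventually.of_forall fun _ => ENNReal.ofReal_lt_top)]
  refine integral_congr_ae (Filter.Eventually.of_forall fun y => ?_)
  simp only
  rw [ENNReal.toReal_ofReal (c.areaDensity_pos y).le, smul_eq_mul]

lemma setIntegral_subgraph_fderiv_eq {f : Euc (d + 1) → ℝ} (hf : ContDiff ℝ 1 f)
    (hc : HasCompactSupport f) (hs : tsupport f ⊆ c.nbhd) (e : Euc (d + 1)) :
    ∫ x in c.subgraph, fderiv ℝ f x e = ∫ x, f x * ⟪c.graphNormal x, e⟫_ℝ ∂c.graphMeasure := by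
  have hm := c.measurable_graphNormal
  have hfm := hf.continuous.measurable
  have hg : Measurable fun x => f x * ⟪c.graphNormal x, e⟫_ℝ := hfm.mul (hm.inner measurable_const)
  rw [c.setIntegral_subgraph_fderiv hf hc, c.integral_graphMeasure hg
    (fun x hx => by rw [image_eq_zero_of_notMem_tsupport fun h => hx (hs h), zero_mul])]
  refine integral_congr_ae (Filter.Eventually.of_forall fun y => ?_)
  have := (c.areaDensity_pos y).ne'
  simp only [graphNormal, base_point, real_inner_smul_left]
  field_simp

end LipschitzChart

/-! ### Compatibility of the charts and the Gauss-Green formula on the domain -/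

namespace LipschitzDomain

variable {d : ℕ} (D : LipschitzDomain d)

/-- The Gauss-Green formula for functions supported in a chart. -/
lemma setIntegral_fderiv_chart (i : Fin D.N) {f : Euc (d + 1) → ℝ} (hf : ContDiff ℝ 1 f)
    (hc : HasCompactSupport f) (hs : tsupport f ⊆ (D.chart i).nbhd) (e : Euc (d + 1)) :
    ∫ x in D.carrier, fderiv ℝ f x e
      = ∫ x, f x * ⟪(D.chart i).graphNormal x, e⟫_ℝ ∂(D.chart i).graphMeasure := by
  rw [← (D.chart i).setIntegral_subgraph_fderiv_eq hf hc hs,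
    ← integral_indicator D.isOpen.measurableSet,
    ← integral_indicator (D.chart i).measurableSet_subgraph]
  congr 1
  funext x
  by_cases hx : x ∈ (D.chart i).nbhd
  · have : x ∈ D.carrier ↔ x ∈ (D.chart i).subgraph := D.mem_iff i x hx
    by_cases h : x ∈ D.carrier
    · rw [indicator_of_mem h, indicator_of_mem (this.1 h)]
    · rw [indicator_of_notMem h, indicator_of_notMem (fun h' => h (this.2 h'))]
  · have h0 : fderiv ℝ f x e = 0 := by
      rw [image_eq_zero_of_notMem_tsupport (f := fderiv ℝ f)
        fun h => hx (hs (tsupport_fderiv_subset ℝ h))]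
      simp
    simp [indicator, h0]

end LipschitzDomain

/-- Two unit vector fields `ν, ν'` and finite measures `σ, σ'` with `ν σ = ν' σ'` on an open set as
vector measures agree there. -/
lemma restrict_eq_and_ae_eq_of_integral_eq {E : Type*} [NormedAddCommGroup E]
    [InnerProductSpace ℝ E] [FiniteDimensional ℝ E] [MeasurableSpace E] [BorelSpace E]
    {σ σ' : Measure E} [IsFiniteMeasure σ] [IsFiniteMeasure σ'] {ν ν' : E → E}
    (hν : Measurable ν) (hν' : Measurable ν') (h1 : ∀ x, ‖ν x‖ = 1) (h1' : ∀ x, ‖ν' x‖ = 1)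
    {O : Set E} (hO : IsOpen O)
    (h : ∀ ψ : E → ℝ, ContDiff ℝ ∞ ψ → HasCompactSupport ψ → tsupport ψ ⊆ O → ∀ e : E,
      ∫ x, ψ x * ⟪ν x, e⟫_ℝ ∂σ = ∫ x, ψ x * ⟪ν' x, e⟫_ℝ ∂σ') :
    σ.restrict O = σ'.restrict O ∧ ∀ᵐ x ∂σ, x ∈ O → ν x = ν' x := by
  -- Both measures have densities with respect to their sum, so the hypothesis becomes an equality
  -- almost everywhere on `O` of the vector densities.
  set μ : Measure E := σ + σ' with hμ
  have hac : σ ≪ μ := Measure.AbsolutelyContinuous.rfl.add_right _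
  have hac' : σ' ≪ μ := by
    rw [hμ, add_comm]; exact Measure.AbsolutelyContinuous.rfl.add_right _
  have hr : ∀ {τ : Measure E} [IsFiniteMeasure τ] {n : E → E}, Measurable n → (∀ x, ‖n x‖ = 1) →
      Integrable (fun x => (τ.rnDeriv μ x).toReal • n x) μ := by
    intro τ _ n hn hn1
    refine Measure.integrable_toReal_rnDeriv (μ := τ) (ν := μ) |>.mono
      ((Measure.measurable_rnDeriv τ μ).ennreal_toReal.smul hn).aestronglyMeasurable
      (Filter.Eventually.of_forall fun x => ?_)
    rw [norm_smul, hn1, mul_one]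
  have hi := hr (τ := σ) hν h1
  have hi' := hr (τ := σ') hν' h1'
  have hz : ∀ᵐ x ∂μ, x ∈ O →
      (σ.rnDeriv μ x).toReal • ν x - (σ'.rnDeriv μ x).toReal • ν' x = 0 := by
    refine hO.ae_eq_zero_of_integral_contDiff_smul_eq_zero
      ((hi.sub hi').locallyIntegrable.locallyIntegrableOn O) fun ψ hψ hψc hψs => ?_
    obtain ⟨C, hC⟩ := hψc.exists_bound_of_continuous hψ.continuous
    have hb : Integrable (fun x => ψ x • (σ.rnDeriv μ x).toReal • ν x) μ :=
      hi.bdd_smul C hψ.continuous.aestronglyMeasurable (Filter.Eventually.of_forall hC)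
    have hb' : Integrable (fun x => ψ x • (σ'.rnDeriv μ x).toReal • ν' x) μ :=
      hi'.bdd_smul C hψ.continuous.aestronglyMeasurable (Filter.Eventually.of_forall hC)
    simp only [smul_sub]
    rw [integral_sub hb hb', sub_eq_zero]
    refine ext_inner_left ℝ fun e => ?_
    rw [← integral_inner hb, ← integral_inner hb']
    have k1 := integral_rnDeriv_smul hac (f := fun x => ψ x * ⟪ν x, e⟫_ℝ)
    have k2 := integral_rnDeriv_smul hac' (f := fun x => ψ x * ⟪ν' x, e⟫_ℝ)
    have k3 := k1.trans ((h ψ hψ hψc hψs e).trans k2.symm)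
    convert! k3 using 3
    · simp only [inner_smul_right, smul_eq_mul, real_inner_comm e]; ring
    · simp only [inner_smul_right, smul_eq_mul, real_inner_comm e]; ring
  -- Taking norms of the vector densities leaves the scalar ones, as `ν` and `ν'` are unit fields.
  have heq : ∀ᵐ x ∂μ, x ∈ O → σ.rnDeriv μ x = σ'.rnDeriv μ x := by
    filter_upwards [hz, Measure.rnDeriv_lt_top σ μ, Measure.rnDeriv_lt_top σ' μ] with x hx h2 h3 hxO
    have h4 := congrArg norm (sub_eq_zero.1 (hx hxO))
    rw [norm_smul, norm_smul, h1, h1', mul_one, mul_one,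
      Real.norm_of_nonneg ENNReal.toReal_nonneg, Real.norm_of_nonneg ENNReal.toReal_nonneg] at h4
    exact (ENNReal.toReal_eq_toReal_iff' h2.ne h3.ne).1 h4
  constructor
  · rw [← Measure.withDensity_rnDeriv_eq σ μ hac, ← Measure.withDensity_rnDeriv_eq σ' μ hac',
      restrict_withDensity hO.measurableSet, restrict_withDensity hO.measurableSet]
    refine withDensity_congr_ae ?_
    exact (ae_restrict_iff' hO.measurableSet).2 heq
  -- The density of `σ` is positive `σ`-almost everywhere and can be cancelled.
  · filter_upwards [hac.ae_le hz, hac.ae_le heq, Measure.rnDeriv_pos hac,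
      hac.ae_le (Measure.rnDeriv_lt_top σ μ)] with x hx h2 h3 h4 hxO
    have h5 := hx hxO
    rw [← h2 hxO, ← smul_sub] at h5
    rcases smul_eq_zero.1 h5 with h6 | h6
    · exact absurd h6 (ENNReal.toReal_pos h3.ne' h4.ne).ne'
    · exact sub_eq_zero.1 h6

namespace LipschitzDomain

variable {d : ℕ} (D : LipschitzDomain d)

/-- For `ψ` supported in the overlap, the local Gauss-Green formula of either chart computes the
same integral of `∂ₑψ` over `Ω`. This replaces a change of variables between the two graphs. -/
lemma graphMeasure_overlap (i j : Fin D.N) :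
    (D.chart i).graphMeasure.restrict ((D.chart i).nbhd ∩ (D.chart j).nbhd)
      = (D.chart j).graphMeasure.restrict ((D.chart i).nbhd ∩ (D.chart j).nbhd) ∧
    ∀ᵐ x ∂(D.chart i).graphMeasure, x ∈ (D.chart i).nbhd ∩ (D.chart j).nbhd →
      (D.chart i).graphNormal x = (D.chart j).graphNormal x := by
  refine restrict_eq_and_ae_eq_of_integral_eq (D.chart i).measurable_graphNormal
    (D.chart j).measurable_graphNormal (D.chart i).norm_graphNormal (D.chart j).norm_graphNormal
    ((D.chart i).isOpen_nbhd.inter (D.chart j).isOpen_nbhd) fun ψ hψ hc hs e => ?_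
  rw [← D.setIntegral_fderiv_chart i (hψ.of_le (by simp)) hc (hs.trans inter_subset_left),
    ← D.setIntegral_fderiv_chart j (hψ.of_le (by simp)) hc (hs.trans inter_subset_right)]

lemma piece_subset (i : Fin D.N) : D.piece i ⊆ (D.chart i).nbhd := sdiff_subset

lemma pairwise_disjoint_piece : Pairwise (Function.onFun Disjoint D.piece) := by
  have : ∀ i j : Fin D.N, i < j → Disjoint (D.piece i) (D.piece j) := fun i j hij =>
    disjoint_left.2 fun x hx hx' => hx'.2 (mem_iUnion₂.2 ⟨i, hij, hx.1⟩)
  intro i j hij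
  rcases lt_or_gt_of_ne hij with h | h
  exacts [this i j h, (this j i h).symm]

lemma exists_mem_piece {x : Euc (d + 1)} {i : Fin D.N} (hx : x ∈ (D.chart i).nbhd) :
    ∃ j, x ∈ D.piece j := by
  obtain ⟨j, hj, hmin⟩ := WellFounded.has_min (wellFounded_lt (α := Fin D.N))
    {i | x ∈ (D.chart i).nbhd} ⟨i, hx⟩
  refine ⟨j, hj, fun h => ?_⟩
  obtain ⟨k, hk, hxk⟩ := mem_iUnion₂.1 h
  exact hmin k hxk hk

lemma normal_eq {x : Euc (d + 1)} {j : Fin D.N} (hx : x ∈ D.piece j) :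
    D.normal x = (D.chart j).graphNormal x := by
  unfold normal
  rw [Finset.sum_eq_single j, indicator_of_mem hx]
  · intro k _ hk
    exact indicator_of_notMem (fun h => disjoint_left.1 (D.pairwise_disjoint_piece hk) h hx) _
  · simp

/-- On the part of piece `j` that lies in chart `i`, the graph measure of `j` can be exchanged for
that of `i`, and these parts exhaust chart `i`. Hence the choice made in disjointifying the charts
is immaterial. -/
lemma surfaceMeasure_restrict (i : Fin D.N) :
    D.surfaceMeasure.restrict (D.chart i).nbhd = (D.chart i).graphMeasure := by
  have hmi := (D.chart i).isOpen_nbhd.measurableSet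
  have hself : (D.chart i).graphMeasure.restrict (D.chart i).nbhd = (D.chart i).graphMeasure := by
    rw [LipschitzChart.graphMeasure, Measure.restrict_restrict hmi, inter_self]
  have hun : (⋃ j, D.piece j ∩ (D.chart i).nbhd) = (D.chart i).nbhd := by
    refine subset_antisymm (iUnion_subset fun j => inter_subset_right) fun x hx => ?_
    obtain ⟨j, hj⟩ := D.exists_mem_piece hx
    exact mem_iUnion.2 ⟨j, hj, hx⟩
  have hpair : Pairwise (Function.onFun Disjoint fun j => D.piece j ∩ (D.chart i).nbhd) :=
    fun j k hjk => (D.pairwise_disjoint_piece hjk).mono inter_subset_left inter_subset_left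
  have h1 : ∀ j, ((D.chart j).graphMeasure.restrict (D.piece j)).restrict (D.chart i).nbhd
      = (D.chart i).graphMeasure.restrict (D.piece j ∩ (D.chart i).nbhd) := fun j => by
    have hsub : D.piece j ∩ (D.chart i).nbhd ⊆ (D.chart i).nbhd ∩ (D.chart j).nbhd :=
      fun x hx => ⟨hx.2, D.piece_subset j hx.1⟩
    rw [Measure.restrict_restrict hmi, inter_comm, ← Measure.restrict_restrict_of_subset hsub,
      ← (D.graphMeasure_overlap i j).1, Measure.restrict_restrict_of_subset hsub]
  conv_rhs => rw [← hself, ← hun]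
  rw [Measure.restrict_iUnion hpair fun j => (D.measurableSet_piece j).inter hmi,
    Measure.sum_fintype]
  simp only [← h1]
  ext s hs
  rw [Measure.restrict_apply hs, surfaceMeasure, Measure.finsetSum_apply, Measure.finsetSum_apply]
  exact Finset.sum_congr rfl fun j _ => (Measure.restrict_apply hs).symm

lemma ae_normal_eq (i : Fin D.N) :
    ∀ᵐ x ∂(D.chart i).graphMeasure, D.normal x = (D.chart i).graphNormal x := by
  have h1 : ∀ᵐ x ∂(D.chart i).graphMeasure, x ∈ (D.chart i).nbhd :=
    ae_restrict_mem (D.chart i).isOpen_nbhd.measurableSet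
  filter_upwards [h1, ae_all_iff.2 fun j => (D.graphMeasure_overlap i j).2] with x hx hall
  obtain ⟨j, hj⟩ := D.exists_mem_piece hx
  rw [D.normal_eq hj, hall j ⟨hx, D.piece_subset j hj⟩]

/-- A point of the graph violates the strict inequality that defines `Ω`, but it is the limit of the
points vertically below it, which satisfy it. -/
lemma ae_graphMeasure_mem_frontier (i : Fin D.N) :
    ∀ᵐ x ∂(D.chart i).graphMeasure, x ∈ frontier D.carrier := by
  set c := D.chart i with hci
  have h1 : ∀ᵐ x ∂c.graphMeasure, x ∈ c.nbhd := ae_restrict_mem c.isOpen_nbhd.measurableSet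
  have hcl : MeasurableSet {x | c.height x = c.φ (c.base x)} :=
    (isClosed_eq c.continuous_height (c.continuous_φ.comp c.continuous_base)).measurableSet
  have h2 : ∀ᵐ x ∂c.graphMeasure, c.height x = c.φ (c.base x) := by
    refine ae_restrict_of_ae ?_
    rw [ae_map_iff c.measurable_graph.aemeasurable hcl]
    exact Filter.Eventually.of_forall fun y => by simp [c.base_point, c.height_point]
  filter_upwards [h1, h2] with x hx hg
  rw [D.isOpen.frontier_eq]
  refine ⟨?_, fun hxc => (((D.mem_iff i x hx).1 hxc).ne hg)⟩
  have hcont : Continuous fun s : ℝ => x + (-s) • c.up := by fun_prop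
  have ht : Filter.Tendsto (fun s : ℝ => x + (-s) • c.up) (nhdsWithin 0 (Ioi 0)) (nhds x) := by
    have := (hcont.tendsto 0).mono_left (nhdsWithin_le_nhds (s := Ioi 0))
    simpa using this
  refine mem_closure_of_tendsto ht ?_
  filter_upwards [ht (c.isOpen_nbhd.mem_nhds hx), self_mem_nhdsWithin] with s hs hs0
  refine (D.mem_iff i _ hs).2 ?_
  rw [← hci, c.height_add, c.base_add, c.base_smul_up, c.height_smul_up, add_zero, hg]
  have : (0 : ℝ) < s := hs0
  linarith

lemma ae_mem_frontier : ∀ᵐ x ∂D.surfaceMeasure, x ∈ frontier D.carrier := by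
  have h : ∀ᵐ x ∂D.surfaceMeasure, ∀ i, x ∈ (D.chart i).nbhd → x ∈ frontier D.carrier := by
    refine ae_all_iff.2 fun i => ?_
    rw [← ae_restrict_iff' (D.chart i).isOpen_nbhd.measurableSet, surfaceMeasure_restrict]
    exact D.ae_graphMeasure_mem_frontier i
  filter_upwards [h, D.ae_surfaceMeasure] with x hx hu
  obtain ⟨i, hi⟩ := mem_iUnion.1 hu
  exact hx i hi

lemma integrable_boundary {f : Euc (d + 1) → ℝ} (hf : Continuous f) :
    Integrable f D.surfaceMeasure :=
  (D.memLp_boundary hf).integrable (by norm_num)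

lemma integrable_mul_normal {f : Euc (d + 1) → ℝ} (hf : Continuous f) (e : Euc (d + 1)) :
    Integrable (fun x => f x * ⟪D.normal x, e⟫_ℝ) D.surfaceMeasure := by
  refine (D.integrable_boundary hf).mul_bdd (c := D.N * ‖e‖)
    (D.measurable_normal.inner measurable_const).aestronglyMeasurable
    (Filter.Eventually.of_forall fun x => (norm_inner_le_norm _ _).trans ?_)
  gcongr
  exact D.norm_normal_le x

lemma integrable_carrier {f : Euc (d + 1) → ℝ} (hf : Continuous f) :
    Integrable f (volume.restrict D.carrier) :=
  (D.memLp_carrier hf).integrable (by norm_num)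

/-- The Gauss-Green formula for functions supported in a chart, in terms of the surface measure. -/
lemma setIntegral_fderiv_of_tsupport_subset (i : Fin D.N) {f : Euc (d + 1) → ℝ}
    (hf : ContDiff ℝ 1 f) (hc : HasCompactSupport f) (hs : tsupport f ⊆ (D.chart i).nbhd)
    (e : Euc (d + 1)) :
    ∫ x in D.carrier, fderiv ℝ f x e = ∫ x, f x * ⟪D.normal x, e⟫_ℝ ∂D.surfaceMeasure := by
  rw [D.setIntegral_fderiv_chart i hf hc hs, ← setIntegral_eq_integral_of_forall_compl_eq_zero
    (s := (D.chart i).nbhd) (μ := D.surfaceMeasure)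
    (fun x hx => by rw [image_eq_zero_of_notMem_tsupport fun h => hx (hs h), zero_mul]),
    surfaceMeasure_restrict]
  refine integral_congr_ae ?_
  filter_upwards [D.ae_normal_eq i] with x hx
  rw [hx]

/-- The Gauss-Green formula. -/
lemma setIntegral_fderiv {f : Euc (d + 1) → ℝ} (hf : ContDiff ℝ ∞ f) (e : Euc (d + 1)) :
    ∫ x in D.carrier, fderiv ℝ f x e = ∫ x, f x * ⟪D.normal x, e⟫_ℝ ∂D.surfaceMeasure := by
  obtain ⟨χ, hχ, hχc, -, hχ0, hχi, hχ1⟩ := D.exists_partition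
  have hs : ∀ j, ContDiff ℝ ∞ fun x => χ j x * f x := fun j => (hχ j).mul hf
  have hsub : ∀ j, tsupport (fun x => χ j x * f x) ⊆ tsupport (χ j) := fun j =>
    tsupport_mul_subset_left
  have hcs : ∀ j, HasCompactSupport fun x => χ j x * f x := fun j => (hχc j).mul_right
  have h1 : ∫ x in D.carrier, fderiv ℝ f x e
      = ∑ j, ∫ x in D.carrier, fderiv ℝ (fun x => χ j x * f x) x e := by
    rw [← integral_finsetSum _ fun j _ => D.integrable_carrier
      (((hs j).continuous_fderiv (by simp)).clm_apply continuous_const)]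
    refine setIntegral_congr_fun D.isOpen.measurableSet fun x hx => ?_
    have h2 : (fun y => ∑ j, χ j y * f y) =ᶠ[nhds x] f := by
      filter_upwards [D.isOpen.mem_nhds hx] with y hy
      rw [← Finset.sum_mul, hχ1 y (subset_closure hy), one_mul]
    rw [← h2.fderiv_eq, fderiv_fun_sum fun j _ => (hs j).differentiable (by simp) x]
    simp only [_root_.sum_apply]
  -- The interior part is a test function; it is paired with the constant `1`, whose derivative
  -- vanishes.
  have h0 : ∫ x in D.carrier, fderiv ℝ (fun x => χ none x * f x) x e = 0 := by
    have := D.integral_mul_fderiv (φ := fun _ => 1) contDiff_const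
      ⟨hs none, hcs none, (hsub none).trans hχ0⟩ e
    simpa using this
  have hi : ∀ i : Fin D.N, ∫ x in D.carrier, fderiv ℝ (fun x => χ (some i) x * f x) x e
      = ∫ x, χ (some i) x * f x * ⟪D.normal x, e⟫_ℝ ∂D.surfaceMeasure := fun i =>
    D.setIntegral_fderiv_of_tsupport_subset i ((hs _).of_le (by simp)) (hcs _)
      ((hsub _).trans (hχi i)) e
  rw [h1, Fintype.sum_option, h0, zero_add, Finset.sum_congr rfl fun i _ => hi i,
    ← integral_finsetSum _ fun i _ => D.integrable_mul_normal (hs (some i)).continuous e]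
  refine integral_congr_ae ?_
  filter_upwards [D.ae_mem_frontier] with x hx
  -- On the boundary the interior cut-off vanishes, so the chart cut-offs alone sum to one.
  have h3 := hχ1 x hx.1
  rw [D.isOpen.frontier_eq] at hx
  rw [Fintype.sum_option, image_eq_zero_of_notMem_tsupport fun h => hx.2 (hχ0 h), zero_add] at h3
  rw [← Finset.sum_mul, ← Finset.sum_mul, h3, one_mul]

end LipschitzDomain

lemma inner_toLp_toLp {α F : Type*} [MeasurableSpace α] {μ : Measure α} [NormedAddCommGroup F]
    [InnerProductSpace ℝ F] {f g : α → F} (hf : MemLp f 2 μ) (hg : MemLp g 2 μ) :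
    ⟪hf.toLp f, hg.toLp g⟫_ℝ = ∫ x, ⟪f x, g x⟫_ℝ ∂μ := by
  rw [L2.inner_def]
  refine integral_congr_ae ?_
  filter_upwards [hf.coeFn_toLp, hg.coeFn_toLp] with x h1 h2
  rw [h1, h2]

lemma norm_toLp_sq {α F : Type*} [MeasurableSpace α] {μ : Measure α} [NormedAddCommGroup F]
    [InnerProductSpace ℝ F] {f : α → F} (hf : MemLp f 2 μ) :
    ‖hf.toLp f‖ ^ 2 = ∫ x, ‖f x‖ ^ 2 ∂μ := by
  rw [← real_inner_self_eq_norm_sq, inner_toLp_toLp]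
  simp only [real_inner_self_eq_norm_sq]

namespace LipschitzDomain

variable {d : ℕ} (D : LipschitzDomain d)

/-! ### The Dirichlet trace -/

lemma norm_smoothToH1_sq (φ : smoothFunctions (d + 1) ℝ) :
    ‖D.smoothToH1 φ‖ ^ 2
      = (∫ x in D.carrier, φ.1 x ^ 2) + ∫ x in D.carrier, ‖gradient φ.1 x‖ ^ 2 := by
  have h1 := WithLp.prod_norm_sq_eq_of_L2 (D.smoothToH1Submodule φ).1
  have h2 := norm_toLp_sq (D.memLp_carrier (contDiff_of_smooth φ).continuous)
  have h3 := norm_toLp_sq (D.memLp_carrier (continuous_gradient (contDiff_of_smooth φ)))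
  simp only [Real.norm_eq_abs, sq_abs] at h2
  rw [← h2, ← h3]
  exact h1

lemma norm_smoothTrace_sq (φ : smoothFunctions (d + 1) ℝ) :
    ‖D.smoothTrace φ‖ ^ 2 = ∫ x, φ.1 x ^ 2 ∂D.surfaceMeasure := by
  have h2 := norm_toLp_sq (D.memLp_boundary (contDiff_of_smooth φ).continuous)
  simp only [Real.norm_eq_abs, sq_abs] at h2
  exact h2

/-- In the chart `ν · up` is the reciprocal of the area density, hence at least `1 / M`. The
boundary integral is therefore at most `M` times the flux of `χ φ² up`, which Gauss-Green turns into
a volume integral of `∂_up (χ φ²)`. -/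
lemma exists_integral_boundary_le (i : Fin D.N) {χ : Euc (d + 1) → ℝ} (hχ : ContDiff ℝ ∞ χ)
    (hc : HasCompactSupport χ) (h0 : ∀ x, 0 ≤ χ x) (hs : tsupport χ ⊆ (D.chart i).nbhd) :
    ∃ C : ℝ, 0 ≤ C ∧ ∀ φ : smoothFunctions (d + 1) ℝ,
      ∫ x, χ x * φ.1 x ^ 2 ∂D.surfaceMeasure ≤ C * ‖D.smoothToH1 φ‖ ^ 2 := by
  set c := D.chart i with hci
  obtain ⟨M, hM⟩ := c.areaDensity_le
  have hM0 : 0 ≤ M := (c.areaDensity_pos 0).le.trans (hM 0)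
  obtain ⟨C₁, hC₁⟩ := hc.exists_bound_of_continuous hχ.continuous
  obtain ⟨C₂, hC₂⟩ := (hc.fderiv_apply ℝ c.up).exists_bound_of_continuous
    ((hχ.continuous_fderiv (by simp)).clm_apply continuous_const)
  have hC₁0 : 0 ≤ C₁ := (norm_nonneg _).trans (hC₁ 0)
  have hC₂0 : 0 ≤ C₂ := (norm_nonneg _).trans (hC₂ 0)
  -- `C₁` bounds `χ` and `C₂` bounds `∂_up χ`; the mixed term `2 φ ∂_up φ` is absorbed by `φ² +
  -- |∇φ|²`.
  refine ⟨M * (C₁ + C₂), by positivity, fun φ => ?_⟩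
  have hφ := contDiff_of_smooth φ
  have hsm : ContDiff ℝ ∞ fun x => χ x * φ.1 x ^ 2 := hχ.mul (hφ.pow 2)
  have hsub : tsupport (fun x => χ x * φ.1 x ^ 2) ⊆ tsupport χ := tsupport_mul_subset_left
  have hup : ∀ x, ⟪c.graphNormal x, c.up⟫_ℝ = (c.areaDensity (c.base x))⁻¹ := fun x => by
    rw [LipschitzChart.graphNormal, LipschitzChart.up, real_inner_smul_left, c.inner_point]
    simp
  have hae : ∀ᵐ x ∂D.surfaceMeasure, x ∈ c.nbhd → 1 ≤ M * ⟪D.normal x, c.up⟫_ℝ := by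
    rw [← ae_restrict_iff' c.isOpen_nbhd.measurableSet, hci, surfaceMeasure_restrict]
    filter_upwards [D.ae_normal_eq i] with x hx
    rw [hx, ← hci, hup, ← div_eq_mul_inv, le_div_iff₀ (c.areaDensity_pos _), one_mul]
    exact hM _
  calc ∫ x, χ x * φ.1 x ^ 2 ∂D.surfaceMeasure
      ≤ ∫ x, M * (χ x * φ.1 x ^ 2 * ⟪D.normal x, c.up⟫_ℝ) ∂D.surfaceMeasure := by
        refine integral_mono_ae (D.integrable_boundary hsm.continuous)
          ((D.integrable_mul_normal hsm.continuous c.up).const_mul M) ?_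
        filter_upwards [hae] with x hx
        by_cases hxn : x ∈ c.nbhd
        · have := mul_le_mul_of_nonneg_left (hx hxn)
            (mul_nonneg (h0 x) (sq_nonneg (φ.1 x)))
          linarith
        · rw [image_eq_zero_of_notMem_tsupport fun h => hxn (hs h)]
          simp
    _ = M * ∫ x in D.carrier, fderiv ℝ (fun x => χ x * φ.1 x ^ 2) x c.up := by
        rw [integral_const_mul, D.setIntegral_fderiv hsm]
    _ ≤ M * ∫ x in D.carrier, (C₁ + C₂) * (φ.1 x ^ 2 + ‖gradient φ.1 x‖ ^ 2) := by
        refine mul_le_mul_of_nonneg_left (integral_mono (D.integrable_carrier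
          ((hsm.continuous_fderiv (by simp)).clm_apply continuous_const))
          (D.integrable_carrier (continuous_const.mul ((hφ.continuous.pow 2).add
            ((continuous_gradient hφ).norm.pow 2)))) fun x => ?_) hM0
        have hfd : fderiv ℝ (fun x => χ x * φ.1 x ^ 2) x c.up
            = fderiv ℝ χ x c.up * φ.1 x ^ 2 + χ x * (2 * φ.1 x * fderiv ℝ φ.1 x c.up) := by
          have h1 := (hχ.differentiable (by simp) x).hasFDerivAt.fun_mul
            ((hφ.differentiable (by simp) x).hasFDerivAt.pow 2)
          rw [h1.fderiv]
          simp
          ring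
        have h2 : |fderiv ℝ φ.1 x c.up| ≤ ‖gradient φ.1 x‖ := by
          rw [← inner_gradient_left]
          simpa [c.norm_up] using abs_real_inner_le_norm (gradient φ.1 x) c.up
        have h3 : fderiv ℝ χ x c.up ≤ C₂ := (le_abs_self _).trans (hC₂ x)
        have h4 : χ x ≤ C₁ := (le_abs_self _).trans (hC₁ x)
        have h5 : fderiv ℝ φ.1 x c.up ^ 2 ≤ ‖gradient φ.1 x‖ ^ 2 := by
          rw [← sq_abs]; gcongr
        have h6 : 2 * φ.1 x * fderiv ℝ φ.1 x c.up ≤ φ.1 x ^ 2 + ‖gradient φ.1 x‖ ^ 2 := by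
          nlinarith [sq_nonneg (φ.1 x - fderiv ℝ φ.1 x c.up)]
        have h7 : χ x * (2 * φ.1 x * fderiv ℝ φ.1 x c.up)
            ≤ C₁ * (φ.1 x ^ 2 + ‖gradient φ.1 x‖ ^ 2) :=
          (mul_le_mul_of_nonneg_left h6 (h0 x)).trans
            (mul_le_mul_of_nonneg_right h4 (by positivity))
        have h8 : fderiv ℝ χ x c.up * φ.1 x ^ 2 ≤ C₂ * (φ.1 x ^ 2 + ‖gradient φ.1 x‖ ^ 2) :=
          (mul_le_mul_of_nonneg_right h3 (by positivity)).trans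
            (mul_le_mul_of_nonneg_left (by linarith [sq_nonneg ‖gradient φ.1 x‖]) hC₂0)
        simp only [hfd]
        linarith
    _ = M * (C₁ + C₂) * ‖D.smoothToH1 φ‖ ^ 2 := by
        have hi1 : Integrable (fun x => φ.1 x ^ 2) (volume.restrict D.carrier) :=
          D.integrable_carrier (hφ.continuous.pow 2)
        have hi2 : Integrable (fun x => ‖gradient φ.1 x‖ ^ 2) (volume.restrict D.carrier) :=
          D.integrable_carrier ((continuous_gradient hφ).norm.pow 2)
        rw [integral_const_mul, integral_add hi1 hi2, norm_smoothToH1_sq]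
        ring

lemma exists_norm_smoothTrace_le :
    ∃ C : ℝ, ∀ φ, ‖D.smoothTrace φ‖ ≤ C * ‖D.smoothToH1 φ‖ := by
  obtain ⟨χ, hχ, hχc, hχp, hχ0, hχi, hχ1⟩ := D.exists_partition
  choose C hC0 hC using fun i =>
    D.exists_integral_boundary_le i (hχ (some i)) (hχc (some i)) (hχp (some i)) (hχi i)
  refine ⟨√(∑ i, C i), fun φ => ?_⟩
  have hφ := contDiff_of_smooth φ
  refine le_of_sq_le_sq ?_ (by positivity)
  rw [mul_pow, Real.sq_sqrt (Finset.sum_nonneg fun i _ => hC0 i), norm_smoothTrace_sq,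
    Finset.sum_mul]
  refine le_trans (le_of_eq ?_) (Finset.sum_le_sum fun i _ => hC i φ)
  have hi : ∀ i, Integrable (fun x => χ (some i) x * φ.1 x ^ 2) D.surfaceMeasure := fun i =>
    D.integrable_boundary ((hχ (some i)).continuous.mul (hφ.continuous.pow 2))
  rw [← integral_finsetSum _ fun i _ => hi i]
  refine integral_congr_ae ?_
  filter_upwards [D.ae_mem_frontier] with x hx
  have h3 := hχ1 x hx.1
  rw [D.isOpen.frontier_eq] at hx
  rw [Fintype.sum_option, image_eq_zero_of_notMem_tsupport fun h => hx.2 (hχ0 h), zero_add] at h3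
  rw [← Finset.sum_mul, h3, one_mul]

/-- Density and the norm bound are what make `extendOfNorm` a true extension. -/
lemma dirichletTrace_smoothToH1 (φ : smoothFunctions (d + 1) ℝ) :
    D.dirichletTrace (D.smoothToH1 φ) = D.smoothTrace φ :=
  LinearMap.extendOfNorm_eq D.denseRange_smoothToH1 D.exists_norm_smoothTrace_le φ

/-! ### Green's formula -/

lemma sum_inner_single {n : ℕ} (u v : Euc n) :
    ∑ i, v i * ⟪u, EuclideanSpace.single i 1⟫_ℝ = ⟪u, v⟫_ℝ := by
  conv_rhs => rw [← (EuclideanSpace.basisFun (Fin n) ℝ).sum_repr v, inner_sum]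
  simp [inner_smul_right]

/-- Green's formula for smooth functions. -/
lemma integral_normal_mul {f : Euc (d + 1) → Euc (d + 1)} (hf : ContDiff ℝ ∞ f)
    {φ : Euc (d + 1) → ℝ} (hφ : ContDiff ℝ ∞ φ) :
    ∫ x, ⟪D.normal x, f x⟫_ℝ * φ x ∂D.surfaceMeasure
      = (∫ x in D.carrier, divergence f x * φ x) + ∫ x in D.carrier, ⟪f x, gradient φ x⟫_ℝ := by
  have hfi : ∀ i, ContDiff ℝ ∞ fun x => f x i := fun i => contDiff_euclidean.1 hf i
  have hfφ : ∀ i, ContDiff ℝ ∞ fun x => f x i * φ x := fun i => (hfi i).mul hφ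
  -- Gauss-Green is to be applied to each `fᵢ φ` in the `i`-th coordinate direction.
  have h1 : ∀ x, ⟪D.normal x, f x⟫_ℝ * φ x
      = ∑ i, f x i * φ x * ⟪D.normal x, EuclideanSpace.single i 1⟫_ℝ := fun x => by
    rw [← sum_inner_single, Finset.sum_mul]
    exact Finset.sum_congr rfl fun i _ => by ring
  have hi1 : Integrable (fun x => divergence f x * φ x) (volume.restrict D.carrier) :=
    D.integrable_carrier ((continuous_divergence hf).mul hφ.continuous)
  have hi2 : Integrable (fun x => ⟪f x, gradient φ x⟫_ℝ) (volume.restrict D.carrier) :=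
    D.integrable_carrier (hf.continuous.inner (continuous_gradient hφ))
  simp only [h1]
  rw [integral_finsetSum _ fun i _ => D.integrable_mul_normal (hfφ i).continuous _,
    Finset.sum_congr rfl fun i _ => (D.setIntegral_fderiv (hfφ i) _).symm,
    ← integral_finsetSum _ fun i _ => D.integrable_carrier
      (((hfφ i).continuous_fderiv (by simp)).clm_apply continuous_const),
    ← integral_add hi1 hi2]
  refine integral_congr_ae (Filter.Eventually.of_forall fun x => ?_)
  have h2 : ∀ i, fderiv ℝ (fun x => f x i * φ x) x (EuclideanSpace.single i 1)
      = fderiv ℝ f x (EuclideanSpace.single i 1) i * φ x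
        + f x i * ⟪gradient φ x, EuclideanSpace.single i 1⟫_ℝ := fun i => by
    have h3 : HasFDerivAt (fun y => f y i)
        ((EuclideanSpace.proj (𝕜 := ℝ) i).comp (fderiv ℝ f x)) x :=
      (EuclideanSpace.proj (𝕜 := ℝ) i).hasFDerivAt.comp x
        (hf.differentiable (by simp) x).hasFDerivAt
    rw [(h3.fun_mul (hφ.differentiable (by simp) x).hasFDerivAt).fderiv, inner_gradient_left]
    simp
    ring
  simp only [h2]
  rw [Finset.sum_add_distrib, sum_inner_single, real_inner_comm, divergence, Finset.sum_mul]

/-- The function `ν · f` on the boundary. -/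
noncomputable def normalComponent (f : smoothFunctions (d + 1) (Euc (d + 1))) : D.L2Boundary :=
  (D.memLp_normal_inner ((contDiff_of_smooth f).continuous)).toLp fun x => ⟪D.normal x, f.1 x⟫_ℝ

/-- Both sides are continuous in `u`, so density reduces to smooth `u`. The field stays smooth here,
as `ν · f` must be in `L²(∂Ω)`. -/
lemma inner_toL2_smoothToHdiv (f : smoothFunctions (d + 1) (Euc (d + 1))) (u : D.H1) :
    ⟪D.normalComponent f, D.dirichletTrace u⟫_ℝ
      = ⟪Hdiv.div D (D.smoothToHdiv f), H1.toL2 D u⟫_ℝ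
        + ⟪Hdiv.toL2Vec D (D.smoothToHdiv f), H1.grad D u⟫_ℝ := by
  refine D.denseRange_smoothToH1.induction_on (p := fun u => ⟪D.normalComponent f,
    D.dirichletTrace u⟫_ℝ = ⟪Hdiv.div D (D.smoothToHdiv f), H1.toL2 D u⟫_ℝ
        + ⟪Hdiv.toL2Vec D (D.smoothToHdiv f), H1.grad D u⟫_ℝ) u
    (isClosed_eq (by fun_prop) (by fun_prop)) fun φ => ?_
  have hf := contDiff_of_smooth f
  have hφ := contDiff_of_smooth φ
  rw [dirichletTrace_smoothToH1]
  have h1 := inner_toLp_toLp (D.memLp_normal_inner hf.continuous) (D.memLp_boundary hφ.continuous)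
  have h2 := inner_toLp_toLp (D.memLp_carrier (continuous_divergence hf))
    (D.memLp_carrier hφ.continuous)
  have h3 := inner_toLp_toLp (D.memLp_carrier hf.continuous)
    (D.memLp_carrier (continuous_gradient hφ))
  have h4 := D.integral_normal_mul hf hφ
  refine h1.trans (Eq.trans ?_ (congrArg₂ (· + ·) h2 h3).symm)
  simpa [mul_comm] using h4

/-! ### The splitting of the boundary -/

variable {D} {Γ₀ Γ₁ : Set (Euc (d + 1))}

lemma IsSplitting.measurableSet₀ (hΓ : D.IsSplitting Γ₀ Γ₁) : MeasurableSet Γ₀ := by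
  obtain ⟨O, hO, rfl⟩ := hΓ.relOpen₀
  exact hO.measurableSet.inter isClosed_frontier.measurableSet

lemma IsSplitting.measurableSet₁ (hΓ : D.IsSplitting Γ₀ Γ₁) : MeasurableSet Γ₁ := by
  obtain ⟨O, hO, rfl⟩ := hΓ.relOpen₁
  exact hO.measurableSet.inter isClosed_frontier.measurableSet

lemma IsSplitting.ae_mem (hΓ : D.IsSplitting Γ₀ Γ₁) :
    ∀ᵐ x ∂D.surfaceMeasure, x ∈ Γ₀ ∨ x ∈ Γ₁ := by
  filter_upwards [D.ae_mem_frontier, measure_eq_zero_iff_ae_notMem.1 hΓ.null₀,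
    measure_eq_zero_iff_ae_notMem.1 hΓ.null₁] with x hx h0 h1
  rw [← hΓ.cover] at hx
  rcases hx with h | h
  · exact Or.inl (by_contra fun h' => h0 ⟨h, h'⟩)
  · exact Or.inr (by_contra fun h' => h1 ⟨h, h'⟩)

lemma coeFn_restrictTo (Γ : Set (Euc (d + 1))) (h : D.L2Boundary) :
    D.restrictTo Γ h =ᵐ[D.surfaceMeasure.restrict Γ] h :=
  LpToLpRestrictCLM_coeFn ℝ Γ h

/-- Pairings on the boundary with functions vanishing on `Γ₀` are pairings on `Γ₁`. -/
lemma IsSplitting.inner_restrictTo (hΓ : D.IsSplitting Γ₀ Γ₁) (a b : D.L2Boundary)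
    (hb : D.restrictTo Γ₀ b = 0) :
    ⟪D.restrictTo Γ₁ a, D.restrictTo Γ₁ b⟫_ℝ = ⟪a, b⟫_ℝ := by
  have hb0 : ∀ᵐ x ∂D.surfaceMeasure, x ∈ Γ₀ → b x = 0 := by
    rw [← ae_restrict_iff' hΓ.measurableSet₀]
    have h1 := coeFn_restrictTo Γ₀ b
    rw [hb] at h1
    filter_upwards [h1, Lp.coeFn_zero ℝ 2 (D.surfaceMeasure.restrict Γ₀)] with x h2 h3
    rw [← h2, h3, Pi.zero_apply]
  rw [L2.inner_def, L2.inner_def]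
  refine Eq.trans ?_ (setIntegral_eq_integral_of_ae_compl_eq_zero (s := Γ₁) ?_)
  · refine integral_congr_ae ?_
    filter_upwards [coeFn_restrictTo Γ₁ a, coeFn_restrictTo Γ₁ b] with x h1 h2
    rw [h1, h2]
  · filter_upwards [hb0, hΓ.ae_mem] with x h1 h2 h3
    rw [h1 (h2.resolve_right h3), inner_zero_right]

lemma restrictTo_dirichletTrace (u : D.E0 Γ₀) :
    D.restrictTo Γ₀ (D.dirichletTrace (E0.toH1 D Γ₀ u)) = 0 := u.2

variable (D Γ₀ Γ₁)

lemma pivotDual_apply {X U : Type*} [SeminormedAddCommGroup X] [NormedSpace ℝ X]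
    [NormedAddCommGroup U] [InnerProductSpace ℝ U] (T : X →L[ℝ] U) (g : U) (x : X) :
    pivotDual T g x = ⟪g, T x⟫_ℝ := rfl

/-- The condition defining `E₀` concerns the trace only, so every lift to `H¹(Ω)` of an element of
`𝒲` lies in `E₀`; the quotient norm supplies one of almost minimal norm. -/
lemma exists_K0W_eq (h : D.W Γ₀) {δ : ℝ} (hδ : 0 < δ) :
    ∃ u : D.E0 Γ₀, D.K0W Γ₀ u = h ∧ ‖u‖ < ‖h‖ + δ := by
  obtain ⟨h, hh⟩ := h
  obtain ⟨u, hu, hn⟩ := D.exists_traceHHalf_eq h hδ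
  have hu0 : u ∈ D.E0Submodule Γ₀ := by
    rw [← hu] at hh
    exact hh
  exact ⟨⟨u, hu0⟩, Subtype.ext hu, hn⟩

lemma surjective_K0W : Function.Surjective (D.K0W Γ₀) := fun h =>
  (D.exists_K0W_eq Γ₀ h one_pos).imp fun _ hu => hu.1

/-! ### The normal trace -/

variable {D Γ₀ Γ₁}

/-- Traces of `E₀` vanish on `Γ₀`, so the pairing over `Γ₁` is the pairing over all of `∂Ω`, where
Green's formula applies. -/
lemma IsSplitting.UtoWdual_smoothNormalTrace (hΓ : D.IsSplitting Γ₀ Γ₁)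
    (f : smoothFunctions (d + 1) (Euc (d + 1))) (u : D.E0 Γ₀) :
    D.UtoWdual Γ₀ Γ₁ (D.smoothNormalTrace Γ₁ f) (D.K0W Γ₀ u)
      = ⟪Hdiv.div D (D.smoothToHdiv f), H1.toL2 D (E0.toH1 D Γ₀ u)⟫_ℝ
        + ⟪Hdiv.toL2Vec D (D.smoothToHdiv f), H1.grad D (E0.toH1 D Γ₀ u)⟫_ℝ := by
  rw [← inner_toL2_smoothToHdiv, ← hΓ.inner_restrictTo _ _ (restrictTo_dirichletTrace u)]
  rfl

lemma norm_fst_le {X Y : Type*} [NormedAddCommGroup X] [NormedAddCommGroup Y]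
    (p : WithLp 2 (X × Y)) : ‖p.fst‖ ≤ ‖p‖ := by
  have h := WithLp.prod_norm_sq_eq_of_L2 p
  exact le_of_sq_le_sq (by nlinarith [sq_nonneg ‖p.snd‖]) (norm_nonneg _)

lemma norm_snd_le {X Y : Type*} [NormedAddCommGroup X] [NormedAddCommGroup Y]
    (p : WithLp 2 (X × Y)) : ‖p.snd‖ ≤ ‖p‖ := by
  have h := WithLp.prod_norm_sq_eq_of_L2 p
  exact le_of_sq_le_sq (by nlinarith [sq_nonneg ‖p.fst‖]) (norm_nonneg _)

/-- Cauchy-Schwarz on the two terms of Green's formula, whence the factor `2`, bounds the pairing by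
the norm of any lift `u` of `h`. -/
lemma IsSplitting.norm_UtoWdual_smoothNormalTrace_le (hΓ : D.IsSplitting Γ₀ Γ₁)
    (f : smoothFunctions (d + 1) (Euc (d + 1))) :
    ‖D.UtoWdual Γ₀ Γ₁ (D.smoothNormalTrace Γ₁ f)‖ ≤ 2 * ‖D.smoothToHdiv f‖ := by
  refine ContinuousLinearMap.opNorm_le_bound _ (by positivity) fun h => ?_
  have key : ∀ u : D.E0 Γ₀, |D.UtoWdual Γ₀ Γ₁ (D.smoothNormalTrace Γ₁ f) (D.K0W Γ₀ u)|
      ≤ 2 * ‖D.smoothToHdiv f‖ * ‖u‖ := fun u => by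
    rw [hΓ.UtoWdual_smoothNormalTrace]
    have h1 : ‖Hdiv.div D (D.smoothToHdiv f)‖ ≤ ‖D.smoothToHdiv f‖ := norm_snd_le _
    have h2 : ‖Hdiv.toL2Vec D (D.smoothToHdiv f)‖ ≤ ‖D.smoothToHdiv f‖ := norm_fst_le _
    have h3 : ‖H1.toL2 D (E0.toH1 D Γ₀ u)‖ ≤ ‖u‖ := norm_fst_le _
    have h4 : ‖H1.grad D (E0.toH1 D Γ₀ u)‖ ≤ ‖u‖ := norm_snd_le _
    calc _ ≤ _ := abs_add_le _ _
      _ ≤ ‖D.smoothToHdiv f‖ * ‖u‖ + ‖D.smoothToHdiv f‖ * ‖u‖ := by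
        refine add_le_add ((abs_real_inner_le_norm _ _).trans ?_)
          ((abs_real_inner_le_norm _ _).trans ?_)
        · gcongr
        · gcongr
      _ = _ := by ring
  -- The lifts have norm below `‖h‖ + δ`, and `δ` tends to zero.
  have hlim : Filter.Tendsto (fun δ : ℝ => 2 * ‖D.smoothToHdiv f‖ * (‖h‖ + δ))
      (nhdsWithin 0 (Ioi 0)) (nhds (2 * ‖D.smoothToHdiv f‖ * ‖h‖)) := by
    have : Continuous fun δ : ℝ => 2 * ‖D.smoothToHdiv f‖ * (‖h‖ + δ) := by fun_prop
    simpa using (this.tendsto 0).mono_left (nhdsWithin_le_nhds (s := Ioi 0))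
  refine ge_of_tendsto hlim ?_
  filter_upwards [self_mem_nhdsWithin] with δ hδ
  obtain ⟨u, hu, hn⟩ := D.exists_K0W_eq Γ₀ h hδ
  rw [← hu] at hn ⊢
  refine (key u).trans ?_
  gcongr

lemma IsSplitting.normalTrace_smoothToHdiv (hΓ : D.IsSplitting Γ₀ Γ₁)
    (f : smoothFunctions (d + 1) (Euc (d + 1))) :
    D.normalTrace Γ₀ Γ₁ (D.smoothToHdiv f) = D.UtoWdual Γ₀ Γ₁ (D.smoothNormalTrace Γ₁ f) :=
  LinearMap.extendOfNorm_eq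
    (f := (D.UtoWdual Γ₀ Γ₁).toLinearMap ∘ₗ D.smoothNormalTrace Γ₁) D.denseRange_smoothToHdiv
    ⟨2, hΓ.norm_UtoWdual_smoothNormalTrace_le⟩ f

/-- Green's formula on `H^div(Ω) × H¹_{Γ₀}(Ω)`. -/
lemma IsSplitting.normalTrace_K0W (hΓ : D.IsSplitting Γ₀ Γ₁) (f : D.Hdiv) (u : D.E0 Γ₀) :
    D.normalTrace Γ₀ Γ₁ f (D.K0W Γ₀ u)
      = ⟪Hdiv.div D f, H1.toL2 D (E0.toH1 D Γ₀ u)⟫_ℝ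
        + ⟪Hdiv.toL2Vec D f, H1.grad D (E0.toH1 D Γ₀ u)⟫_ℝ := by
  refine D.denseRange_smoothToHdiv.induction_on (p := fun f => D.normalTrace Γ₀ Γ₁ f (D.K0W Γ₀ u)
      = ⟪Hdiv.div D f, H1.toL2 D (E0.toH1 D Γ₀ u)⟫_ℝ
        + ⟪Hdiv.toL2Vec D f, H1.grad D (E0.toH1 D Γ₀ u)⟫_ℝ) f
    (isClosed_eq (by fun_prop) (by fun_prop)) fun f => ?_
  rw [hΓ.normalTrace_smoothToHdiv, hΓ.UtoWdual_smoothNormalTrace]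

lemma IsSplitting.Ldual_eq (hΓ : D.IsSplitting Γ₀ Γ₁) (f : D.Hdiv) :
    D.Ldual Γ₀ (Hdiv.toL2Vec D f)
      = D.L2toE0dual Γ₀ (Hdiv.div D f) - D.K0Wdual Γ₀ (D.normalTrace Γ₀ Γ₁ f) := by
  ext u
  have h1 : D.K0Wdual Γ₀ (D.normalTrace Γ₀ Γ₁ f) u = D.normalTrace Γ₀ Γ₁ f (D.K0W Γ₀ u) := rfl
  rw [sub_apply, h1, hΓ.normalTrace_K0W, Ldual, L2toE0dual, pivotDual_apply,
    pivotDual_apply]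
  simp [L]

/-! ### Injectivity -/

/-- Write `Γ₁ = O ∩ ∂Ω` with `O` open; disjointness keeps `O` away from `Γ₀`. Smooth functions with
compact support in `O` therefore belong to `E₀`, and if `g` is orthogonal to all their traces, it
vanishes by the fundamental lemma of the calculus of variations. -/
lemma IsSplitting.injective_UtoWdual (hΓ : D.IsSplitting Γ₀ Γ₁) :
    Function.Injective (D.UtoWdual Γ₀ Γ₁) := by
  refine (injective_iff_map_eq_zero _).2 fun g hg => ?_
  obtain ⟨O, hO, hΓO⟩ := hΓ.relOpen₁
  obtain ⟨O', -, hΓO'⟩ := hΓ.relOpen₀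
  have hΓ₀O : ∀ x ∈ Γ₀, x ∉ O := fun x hx hxO =>
    disjoint_left.1 hΓ.disjoint hx (hΓO ▸ ⟨hxO, (hΓO' ▸ hx : x ∈ O' ∩ frontier D.carrier).2⟩)
  have hgi : Integrable g (D.surfaceMeasure.restrict Γ₁) := (Lp.memLp g).integrable (by norm_num)
  have key := hO.ae_eq_zero_of_integral_contDiff_smul_eq_zero
    (hgi.locallyIntegrable.locallyIntegrableOn O) fun φ hφ _ hs => ?_
  · rw [Lp.eq_zero_iff_ae_eq_zero]
    filter_upwards [key, ae_restrict_mem hΓ.measurableSet₁] with x h1 h2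
    exact h1 (hΓO ▸ h2 : x ∈ O ∩ frontier D.carrier).1
  · have hb := (D.memLp_boundary hφ.continuous).coeFn_toLp
    have hmem : D.smoothToH1 ⟨φ, hφ⟩ ∈ D.E0Submodule Γ₀ := by
      change D.restrictTo Γ₀ (D.dirichletTrace (D.smoothToH1 ⟨φ, hφ⟩)) = 0
      rw [dirichletTrace_smoothToH1, Lp.eq_zero_iff_ae_eq_zero]
      filter_upwards [coeFn_restrictTo Γ₀ (D.smoothTrace ⟨φ, hφ⟩), ae_restrict_of_ae hb,
        ae_restrict_mem hΓ.measurableSet₀] with x h1 h2 h3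
      rw [h1]
      refine h2.trans ?_
      exact image_eq_zero_of_notMem_tsupport fun h => hΓ₀O x h3 (hs h)
    have h1 : ⟪g, D.restrictTo Γ₁ (D.dirichletTrace (D.smoothToH1 ⟨φ, hφ⟩))⟫_ℝ = 0 :=
      DFunLike.congr_fun hg (D.K0W Γ₀ ⟨_, hmem⟩)
    rw [dirichletTrace_smoothToH1, L2.inner_def] at h1
    rw [← h1]
    refine integral_congr_ae ?_
    filter_upwards [coeFn_restrictTo Γ₁ (D.smoothTrace ⟨φ, hφ⟩), ae_restrict_of_ae hb]
      with x h2 h3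
    have h4 : D.restrictTo Γ₁ (D.smoothTrace ⟨φ, hφ⟩) x = φ x := h2.trans h3
    rw [h4]
    simp

variable (D Γ₀ Γ₁)

lemma K0Wdual_UtoWdual (g : D.L2Part Γ₁) :
    D.K0Wdual Γ₀ (D.UtoWdual Γ₀ Γ₁ g) = D.K0dual Γ₀ Γ₁ g := rfl

/-- The dual of a surjective operator is injective. -/
lemma injective_K0Wdual : Function.Injective (D.K0Wdual Γ₀) := fun a b hab => by
  ext h
  obtain ⟨u, rfl⟩ := D.surjective_K0W Γ₀ h
  exact DFunLike.congr_fun hab u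

end LipschitzDomain

theorem mainTheorem11 {d : ℕ} (D : LipschitzDomain d) (Γ₀ Γ₁ : Set (Euc (d + 1)))
    (hΓ : D.IsSplitting Γ₀ Γ₁) :
    -- the Dirichlet trace is the unique continuous extension of the restriction to the boundary
    (DenseRange D.smoothToH1 ∧ ∀ φ, D.dirichletTrace (D.smoothToH1 φ) = D.smoothTrace φ) ∧
    -- the normal trace is the unique continuous extension of the normal component on `Γ₁`
    (DenseRange D.smoothToHdiv ∧ ∀ f, D.normalTrace Γ₀ Γ₁ (D.smoothToHdiv f)
      = D.UtoWdual Γ₀ Γ₁ (D.smoothNormalTrace Γ₁ f)) ∧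
    -- `K₀' : 𝒲' → E₀'` extends `K₀' : L²(Γ₁) → E₀'`
    (Function.Injective (D.UtoWdual Γ₀ Γ₁) ∧
      ∀ g, D.K0Wdual Γ₀ (D.UtoWdual Γ₀ Γ₁ g) = D.K0dual Γ₀ Γ₁ g) ∧
    -- `L' f = div f - K₀' γ_⊥ f` in `E₀'`
    (∀ f : D.Hdiv, D.Ldual Γ₀ (LipschitzDomain.Hdiv.toL2Vec D f)
      = D.L2toE0dual Γ₀ (LipschitzDomain.Hdiv.div D f) - D.K0Wdual Γ₀ (D.normalTrace Γ₀ Γ₁ f)) ∧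
    -- `K₀'` is injective
    Function.Injective (D.K0dual Γ₀ Γ₁) ∧ Function.Injective (D.K0Wdual Γ₀) := by
  have hU := hΓ.injective_UtoWdual
  have hW := D.injective_K0Wdual Γ₀
  have hext := D.K0Wdual_UtoWdual Γ₀ Γ₁
  refine ⟨⟨D.denseRange_smoothToH1, D.dirichletTrace_smoothToH1⟩,
    ⟨D.denseRange_smoothToHdiv, hΓ.normalTrace_smoothToHdiv⟩, ⟨hU, hext⟩, hΓ.Ldual_eq, ?_, hW⟩
  -- On `U`, `K₀'` is the composition of the injections `U → 𝒲'` and `𝒲' → E₀'`.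
  intro g g' h
  rw [← hext, ← hext] at h
  exact hU (hW h)
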